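/- Let $n\ge 2$ be an integer, $k,c_b,\rho_0>0$, and consider the restricted Euler–Poisson initial value problem $$\lambda_i'=-\lambda_i^2+\frac kn(\rho-c_b)\ (1\le i\le n),\qquad \rho'=-\rho\sum_{i=1}^n\lambda_i\qquad(t>0),\qquad \rho(0)=\rho_0,\quad \lambda_i(0)=\lambda_{i,0},$$ with real initial data satisfying $\lambda_{1,0}=\cdots=\lambda_{J,0}<\lambda_{J+1,0}\le\cdots\le\lambda_{n,0}$, where $1\le J\le n$. Suppose that the maximal interval of existence of the solution is $[0,t_B)$ with $0<t_B<\infty$. Then, with all limits, $\mathcal O$ and $o$ taken as $t\to t_B^-$: 1. If $J=1$, then $n\ge2$, $\lim (t_B-t)\lambda_1(t)=-1$, $\lambda_i(t)=\mathcal O(|\ln(t_B-t)|)$ for $2\le i\le n$, and $\rho(t)=\mathcal O\big(\frac1{t_B-t}\big)$. 2. If $J=2$, then $n\ge4$ and one of the following holds, where $A_0:=(\lambda_{1,0}-\lambda_{3,0})(\lambda_{1,0}-\lambda_{4,0})$: - (a) $n\ge5$, $\lim(t_B-t)\lambda_1(t)=-1$; for $3\le i\le n$, $\lim(t_B-t)\lambda_i(t)=0$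 and $\lim\int_0^t\lambda_i(s)\,ds=\infty$; and $\rho(t)=o\big(\frac1{(t_B-t)^2}\big)$. - (b) $n=4$, $A_0>k\rho_0$, $\lim(t_B-t)\lambda_1(t)=-\frac12-\frac12\sqrt{\frac{A_0}{A_0-k\rho_0}}$; $\lim(t_B-t)\lambda_i(t)=-\frac12+\frac12\sqrt{\frac{A_0}{A_0-k\rho_0}}$ for $i=3,4$; and $\rho(t)=\mathcal O\big(\frac1{(t_B-t)^2}\big)$. - (c) $n=4$, $A_0=k\rho_0$, and there is $C>0$ such that $\lim(t_B-t)^2\lambda_1(t)=-C$, $\lim(t_B-t)^2\lambda_i(t)=C$ for $i=3,4$, and $\lim(t_B-t)^4\rho(t)=\frac4k C^2$. 3. If $J\ge3$, then $n>2J$ and there is $C>1$ such that $\lim(t_B-t)\lambda_1(t)=-C$, $\lim(t_B-t)\lambda_i(t)=C-1$ for $J+1\le i\le n$, and $\rho(t)=\mathcal O\big(\frac1{(t_B-t)^2}\big)$. -/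

import Mathlib

open Filter Topology Asymptotics

/-- The order condition `λ_{1,0} = ⋯ = λ_{J,0} < λ_{J+1,0} ≤ ⋯ ≤ λ_{n,0}` with `1 ≤ J ≤ n`.
Components are numbered `1, …, n`; the values of `lam0` at other indices play no role. -/
structure InitialOrder (n J : ℕ) (lam0 : ℕ → ℝ) : Prop where
  one_le : 1 ≤ J
  le_n : J ≤ n
  eq_first : ∀ i, 1 ≤ i → i ≤ J → lam0 i = lam0 1
  first_lt : ∀ i, J < i → i ≤ n → lam0 1 < lam0 i
  mono : ∀ i j, J < i → i ≤ j → j ≤ n → lam0 i ≤ lam0 j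

/-- `(lam 1, …, lam n, ρ)` solves on `[0, T)` the restricted Euler–Poisson initial value problem
`λ_i' = -λ_i² + (k/n)(ρ - c_b)`, `ρ' = -ρ ∑ λ_i`, `ρ(0) = ρ₀`, `λ_i(0) = λ_{i,0}`: the functions
are continuous on `[0, T)`, take the initial values at `0`, and satisfy the equations on `(0, T)`.
The values of `lam` at indices outside `1, …, n` play no role. -/
structure IsREPSolution (n : ℕ) (k c_b ρ₀ : ℝ) (lam0 : ℕ → ℝ) (T : ℝ)
    (lam : ℕ → ℝ → ℝ) (ρ : ℝ → ℝ) : Prop where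
  lam_cont : ∀ i ∈ Finset.Icc 1 n, ContinuousOn (lam i) (Set.Ico 0 T)
  ρ_cont : ContinuousOn ρ (Set.Ico 0 T)
  lam_init : ∀ i ∈ Finset.Icc 1 n, lam i 0 = lam0 i
  ρ_init : ρ 0 = ρ₀
  lam_deriv : ∀ i ∈ Finset.Icc 1 n, ∀ t ∈ Set.Ioo 0 T,
    HasDerivAt (lam i) (-(lam i t) ^ 2 + k / (n : ℝ) * (ρ t - c_b)) t
  ρ_deriv : ∀ t ∈ Set.Ioo 0 T,
    HasDerivAt ρ (-(ρ t) * ∑ i ∈ Finset.Icc 1 n, lam i t) t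

/-- `[0, T)` is the maximal interval of existence of the restricted Euler–Poisson initial value
problem and `(lam, ρ)` is its solution there: it solves the problem on `[0, T)`, and the problem
has no solution on `[0, T')` for any `T' > T`. -/
def IsMaximalREPSolution (n : ℕ) (k c_b ρ₀ : ℝ) (lam0 : ℕ → ℝ) (T : ℝ)
    (lam : ℕ → ℝ → ℝ) (ρ : ℝ → ℝ) : Prop :=
  IsREPSolution n k c_b ρ₀ lam0 T lam ρ ∧
    ∀ T' > T, ¬ ∃ (lam' : ℕ → ℝ → ℝ) (ρ' : ℝ → ℝ), IsREPSolution n k c_b ρ₀ lam0 T' lam' ρ'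

/-- `A₀ = (λ_{1,0} - λ_{3,0})(λ_{1,0} - λ_{4,0})`, used when `n = 4`. -/
def gapProduct (lam0 : ℕ → ℝ) : ℝ := (lam0 1 - lam0 3) * (lam0 1 - lam0 4)

/-!
Every component satisfies `λᵢ = uᵢ' / uᵢ`, where the functions `uᵢ = exp ∫ λᵢ` all solve the same
linear equation `u'' = (k / n) (ρ - c_b) u`. With `y = u₁`, `w = ∫ y⁻²` and `aᵢ = λᵢ(0) - λ₁(0)`,
constancy of the Wronskians gives `uᵢ = y (1 + aᵢ w)` and
`λᵢ = λ₁ + aᵢ / (y² (1 + aᵢ w))`, and the continuity equation gives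
`ρ = ρ₀ / (yⁿ ∏_{i > J} (1 + aᵢ w))`. So everything is expressed by the smallest component
(`IsREPSolution.expPrimitive_eq`, `component_eq`, `ρ_eq`).

Since `λ₁' ≥ -λ₁² - const`, the component `λ₁` has a limit in `[-∞, ∞]` (`tendsto_of_riccati`). It
is not `+∞`, as then all components would be positive and `ρ` bounded, and not finite, as then the
whole solution would converge and could be continued (`IsMaximalREPSolution.not_tendsto`). Hence
`λ₁ → -∞`; moreover `y → 0`, which is recorded as a `CollapsingFlow`. There `y'` has a limit
`L ≤ 0`, `w → ∞`, `1 / (y w) → -L` and `H = y² w → 0`. If `J = 1`, then `L < 0` (`slope_neg`), so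
`y` vanishes linearly and all the rates follow. If `J ≥ 2`, then `L = 0` (`slope_eq_zero`).

In the time `s = ln w` the quantities `p = -λ₁ H` and `X = (k / n) ρ H²` satisfy
`p' = p (1 - p) - X + (k / n) c_b H²`, `H' = H (1 - 2 p)` and
`X' = X ((n - 4) p - (n - J - 2) + o(1))`, with `H → 0` (`exists_phaseFlow`). Once `p` has a limit
`q > 1 / 2`, `dH / dt = 1 - 2 p` yields `H ~ (2 q - 1) (t_B - t)`, and this gives the rates of all
components and of the density. It remains to find the limit of `p`.

* If `X` has a limit `x`, then `x ≤ 1 / 4`, and for `x < 1 / 4` the limit of `p` is the larger root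
  of `q (1 - q) = x`, the smaller one making `H` grow (`PhaseFlow.tendsto_of_tendsto`). For `J = 2`
  the limit of `X` can be read off: it is `0` if `n ≥ 5`, and `k ρ₀ / (4 A₀)` if `n = 4`. In the
  remaining case `x = 1 / 4`, `(p - 1 / 2) / √H` increases to a positive limit
  (`PhaseFlow.exists_tendsto_div_sqrt`), so `H` vanishes quadratically.
* If `J ≥ 3` and `n ≤ 2 J`, then `X` is `H ^ (-(n - 4) / 2)` times a nondecreasing weight, and an
  energy estimate bounds `1 / H`, which is absurd (`PhaseFlow.not_growing_weight`).
* If `J ≥ 3` and `n > 2 J`, a power of `X` obeys a damped oscillator equation with a double-well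
  potential, and energy dissipation forces `p → (n - J - 2) / (n - 4)`
  (`PhaseFlow.tendsto_of_damped`).
-/

/-! ### Differential inequalities near the right end of an interval -/

/-- A filter on `ℝ` describing the approach from the left to an end point, finite or infinite:
it has arbitrarily small open convex members, and points of such a member are eventually passed.
It lets `𝓝[<] b` and `atTop` be treated at once. -/
class IsLeftApproach (l : Filter ℝ) : Prop where
  neBot : l.NeBot
  exists_tail : ∀ s ∈ l, ∃ u ∈ l, u ⊆ s ∧ IsOpen u ∧ Convex ℝ u ∧ ∀ x ∈ u, ∀ᶠ t in l, x ≤ t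

instance isLeftApproach_nhdsLT (b : ℝ) : IsLeftApproach (𝓝[<] b) where
  neBot := inferInstance
  exists_tail s hs := by
    obtain ⟨a, ha, has⟩ := mem_nhdsLT_iff_exists_Ioo_subset.1 hs
    refine ⟨Set.Ioo a b, Ioo_mem_nhdsLT ha, has, isOpen_Ioo, convex_Ioo a b, fun x hx => ?_⟩
    filter_upwards [Ioo_mem_nhdsLT hx.2] with t ht using ht.1.le

instance isLeftApproach_atTop : IsLeftApproach (atTop : Filter ℝ) where
  neBot := inferInstance
  exists_tail s hs := by
    obtain ⟨a, ha⟩ := mem_atTop_sets.1 hs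
    exact ⟨Set.Ioi a, Ioi_mem_atTop a, fun x hx => ha x (le_of_lt hx), isOpen_Ioi, convex_Ioi a,
      fun x _ => eventually_ge_atTop x⟩

section LeftApproach

variable {l : Filter ℝ} [IsLeftApproach l] {f f' g g' : ℝ → ℝ}

theorem monotoneOn_of_hasDerivAt {u : Set ℝ} (hu : IsOpen u) (hc : Convex ℝ u)
    (hf : ∀ t ∈ u, HasDerivAt f (f' t) t) (h0 : ∀ t ∈ u, 0 ≤ f' t) : MonotoneOn f u := by
  refine monotoneOn_of_hasDerivWithinAt_nonneg (f' := f') hc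
    (fun t ht => (hf t ht).continuousAt.continuousWithinAt) ?_ ?_
  · intro t ht
    rw [hu.interior_eq] at ht ⊢
    exact (hf t ht).hasDerivWithinAt
  · intro t ht
    rw [hu.interior_eq] at ht
    exact h0 t ht

theorem exists_monotoneOn_of_eventually_deriv_nonneg
    (hf : ∀ᶠ t in l, HasDerivAt f (f' t) t) (h0 : ∀ᶠ t in l, 0 ≤ f' t) :
    ∃ u ∈ l, MonotoneOn f u ∧ ∀ x ∈ u, ∀ᶠ t in l, t ∈ u ∧ x ≤ t := by
  obtain ⟨u, hul, hus, huo, huc, hue⟩ := IsLeftApproach.exists_tail _ (hf.and h0)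
  exact ⟨u, hul, monotoneOn_of_hasDerivAt huo huc (fun t ht => (hus ht).1)
    (fun t ht => (hus ht).2), fun x hx => (eventually_mem_set.2 hul).and (hue x hx)⟩

theorem eventually_eventually_le_of_deriv_nonneg
    (hf : ∀ᶠ t in l, HasDerivAt f (f' t) t) (h0 : ∀ᶠ t in l, 0 ≤ f' t) :
    ∀ᶠ x in l, ∀ᶠ t in l, f x ≤ f t := by
  obtain ⟨u, hul, hm, hue⟩ := exists_monotoneOn_of_eventually_deriv_nonneg hf h0
  filter_upwards [hul] with x hx
  filter_upwards [hue x hx] with t ht using hm hx ht.1 ht.2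

theorem exists_le_add_of_deriv_le
    (hf : ∀ᶠ t in l, HasDerivAt f (f' t) t) (hg : ∀ᶠ t in l, HasDerivAt g (g' t) t)
    (h : ∀ᶠ t in l, f' t ≤ g' t) : ∃ C, ∀ᶠ t in l, f t ≤ g t + C := by
  have := IsLeftApproach.neBot (l := l)
  have hd : ∀ᶠ t in l, HasDerivAt (fun t => g t - f t) (g' t - f' t) t := by
    filter_upwards [hf, hg] with t h1 h2 using h2.sub h1
  obtain ⟨x, hx⟩ := (eventually_eventually_le_of_deriv_nonneg hd
    (h.mono fun t ht => sub_nonneg.2 ht)).exists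
  refine ⟨f x - g x, hx.mono fun t ht => ?_⟩
  linarith

/-- Comparison with a function that converges: a one-sided derivative bound and boundedness on the
other side force convergence. -/
theorem exists_tendsto_of_deriv_ge {a M : ℝ}
    (hf : ∀ᶠ t in l, HasDerivAt f (f' t) t) (hg : ∀ᶠ t in l, HasDerivAt g (g' t) t)
    (h : ∀ᶠ t in l, g' t ≤ f' t) (hga : Tendsto g l (𝓝 a)) (hM : ∀ᶠ t in l, f t ≤ M) :
    ∃ b, Tendsto f l (𝓝 b) := by
  have := IsLeftApproach.neBot (l := l)
  have hd : ∀ᶠ t in l, HasDerivAt (fun t => f t - g t) (f' t - g' t) t := by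
    filter_upwards [hf, hg] with t h1 h2 using h1.sub h2
  obtain ⟨u, hul, hm, hue⟩ := exists_monotoneOn_of_eventually_deriv_nonneg hd
    (h.mono fun t ht => sub_nonneg.2 ht)
  have hbd : ∀ᶠ t in l, f t - g t ≤ M - a + 1 := by
    filter_upwards [hM, hga.eventually_const_lt (sub_one_lt a)] with t h1 h2
    linarith
  have hbu : ∀ x ∈ u, f x - g x ≤ M - a + 1 := fun x hx => by
    obtain ⟨t, ht1, ht2⟩ := (hbd.and (hue x hx)).exists
    exact (hm hx ht2.1 ht2.2).trans ht1
  obtain ⟨x₀, hx₀⟩ := nonempty_of_mem hul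
  have hB : BddAbove ((fun t => f t - g t) '' u) := ⟨_, by rintro _ ⟨x, hx, rfl⟩; exact hbu x hx⟩
  have hlim : Tendsto (fun t => f t - g t) l (𝓝 (sSup ((fun t => f t - g t) '' u))) := by
    refine tendsto_order.2 ⟨fun c hc => ?_, fun c hc => ?_⟩
    · obtain ⟨_, ⟨x, hx, rfl⟩, hxc⟩ := exists_lt_of_lt_csSup (Set.Nonempty.image _ ⟨x₀, hx₀⟩) hc
      filter_upwards [hue x hx] with t ht using hxc.trans_le (hm hx ht.1 ht.2)
    · filter_upwards [hul] with t ht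
      exact (le_csSup hB ⟨t, ht, rfl⟩).trans_lt hc
  refine ⟨_, (hlim.add hga).congr fun t => ?_⟩
  ring

theorem exists_tendsto_of_deriv_le {a M : ℝ}
    (hf : ∀ᶠ t in l, HasDerivAt f (f' t) t) (hg : ∀ᶠ t in l, HasDerivAt g (g' t) t)
    (h : ∀ᶠ t in l, f' t ≤ g' t) (hga : Tendsto g l (𝓝 a)) (hM : ∀ᶠ t in l, M ≤ f t) :
    ∃ b, Tendsto f l (𝓝 b) := by
  obtain ⟨b, hb⟩ := exists_tendsto_of_deriv_ge (f := fun t => -f t) (f' := fun t => -f' t)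
    (g := fun t => -g t) (g' := fun t => -g' t) (M := -M) (hf.mono fun t ht => ht.neg)
    (hg.mono fun t ht => ht.neg) (h.mono fun t ht => neg_le_neg ht) hga.neg
    (hM.mono fun t ht => neg_le_neg ht)
  exact ⟨-b, by simpa using hb.neg⟩

/-- **L'Hôpital's rule** for quotients with denominator tending to infinity. -/
theorem tendsto_div_of_deriv_eq_mul {r : ℝ → ℝ} {c : ℝ}
    (hf : ∀ᶠ t in l, HasDerivAt f (r t * g' t) t) (hg : ∀ᶠ t in l, HasDerivAt g (g' t) t)
    (hg0 : ∀ᶠ t in l, 0 ≤ g' t) (hr : Tendsto r l (𝓝 c)) (hgt : Tendsto g l atTop) :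
    Tendsto (fun t => f t / g t) l (𝓝 c) := by
  refine tendsto_order.2 ⟨fun b hb => ?_, fun b hb => ?_⟩
  · obtain ⟨b', hb1, hb2⟩ := exists_between hb
    obtain ⟨C, hC⟩ := exists_le_add_of_deriv_le (l := l) (f := fun t => b' * g t)
      (f' := fun t => b' * g' t) (hg.mono fun t ht => ht.const_mul b') hf (by
        filter_upwards [hr.eventually_const_lt hb2, hg0] with t h1 h2
        exact mul_le_mul_of_nonneg_right h1.le h2)
    filter_upwards [hC, hgt.eventually_gt_atTop 0, hgt.eventually_gt_atTop (C / (b' - b))]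
      with t h1 h2 h3
    rw [lt_div_iff₀ h2]
    rw [div_lt_iff₀ (sub_pos.2 hb1)] at h3
    linarith
  · obtain ⟨b', hb1, hb2⟩ := exists_between hb
    obtain ⟨C, hC⟩ := exists_le_add_of_deriv_le (l := l) (g := fun t => b' * g t)
      (g' := fun t => b' * g' t) hf (hg.mono fun t ht => ht.const_mul b') (by
        filter_upwards [hr.eventually_lt_const hb1, hg0] with t h1 h2
        exact mul_le_mul_of_nonneg_right h1.le h2)
    filter_upwards [hC, hgt.eventually_gt_atTop 0, hgt.eventually_gt_atTop (C / (b - b'))]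
      with t h1 h2 h3
    rw [div_lt_iff₀ h2]
    rw [div_lt_iff₀ (sub_pos.2 hb2)] at h3
    linarith

/-- If the derivative dominates a positive multiple of that of a function tending to infinity, the
function tends to infinity. -/
theorem tendsto_atTop_of_deriv_ge {c : ℝ} (hc : 0 < c)
    (hf : ∀ᶠ t in l, HasDerivAt f (f' t) t) (hg : ∀ᶠ t in l, HasDerivAt g (g' t) t)
    (h : ∀ᶠ t in l, c * g' t ≤ f' t) (hgt : Tendsto g l atTop) : Tendsto f l atTop := by
  obtain ⟨C, hC⟩ := exists_le_add_of_deriv_le (l := l) (f := fun t => c * g t)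
      (f' := fun t => c * g' t) (hg.mono fun t ht => ht.const_mul c) hf h
  refine tendsto_atTop_mono' l (f₁ := fun t => c * g t + -C) ?_
    (tendsto_atTop_add_const_right _ _ (hgt.const_mul_atTop hc))
  filter_upwards [hC] with t ht
  linarith

/-- A lower barrier `B` crossed only upwards traps the function above it. -/
theorem eventually_ge_of_barrier {B : ℝ}
    (hf : ∀ᶠ t in l, HasDerivAt f (f' t) t) (hB : ∀ᶠ t in l, f t = B → 0 < f' t)
    (hfr : ∃ᶠ t in l, B ≤ f t) : ∀ᶠ t in l, B ≤ f t := by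
  obtain ⟨u, hul, hus, -, huc, hue⟩ := IsLeftApproach.exists_tail _ (hf.and hB)
  obtain ⟨x, hxB, hxu⟩ := (hfr.and_eventually hul).exists
  filter_upwards [hul, hue x hxu] with t ht hxt
  have hsub : Set.Icc x t ⊆ u := huc.ordConnected.out hxu ht
  have := image_le_of_deriv_right_lt_deriv_boundary (f := fun s => -f s) (f' := fun s => -f' s)
    (a := x) (b := t) (B := fun _ => -B) (B' := fun _ => 0)
    (fun s hs => ((hus (hsub hs)).1.continuousAt.neg).continuousWithinAt)
    (fun s hs => ((hus (hsub ⟨hs.1, hs.2.le⟩)).1.neg).hasDerivWithinAt)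
    (neg_le_neg hxB) (fun s => hasDerivAt_const s _)
    (fun s hs h => neg_lt_zero.2 ((hus (hsub ⟨hs.1, hs.2.le⟩)).2 (neg_injective h)))
    (Set.right_mem_Icc.2 hxt)
  exact neg_le_neg_iff.1 this

end LeftApproach

/-! ### Behaviour at infinity of functions of one real variable -/

/-- A function that increases at a definite rate while below `B` ends up above `B`. -/
theorem eventually_ge_of_deriv_ge {f f' : ℝ → ℝ} {B c : ℝ} (hc : 0 < c)
    (hf : ∀ᶠ s in atTop, HasDerivAt f (f' s) s) (h : ∀ᶠ s in atTop, f s ≤ B → c ≤ f' s) :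
    ∀ᶠ s in atTop, B ≤ f s := by
  refine eventually_ge_of_barrier hf (h.mono fun s hs he => hc.trans_le (hs he.le)) ?_
  by_contra hcon
  have hlt : ∀ᶠ s in atTop, f s < B := by simpa [not_frequently] using hcon
  have : Tendsto f atTop atTop := tendsto_atTop_of_deriv_ge hc hf
    (Eventually.of_forall fun s => hasDerivAt_id s)
    (by filter_upwards [h, hlt] with s h1 h2 using by simpa using h1 h2.le) tendsto_id
  obtain ⟨s, h1, h2⟩ := (hlt.and (this.eventually_ge_atTop B)).exists
  linarith

theorem eventually_le_of_deriv_le {f f' : ℝ → ℝ} {B c : ℝ} (hc : 0 < c)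
    (hf : ∀ᶠ s in atTop, HasDerivAt f (f' s) s) (h : ∀ᶠ s in atTop, B ≤ f s → f' s ≤ -c) :
    ∀ᶠ s in atTop, f s ≤ B := by
  have := eventually_ge_of_deriv_ge (f := fun s => -f s) (f' := fun s => -f' s) (B := -B) hc
    (hf.mono fun s hs => hs.neg) (h.mono fun s hs he => le_neg_of_le_neg (hs (neg_le_neg_iff.1 he)))
  exact this.mono fun s hs => neg_le_neg_iff.1 hs

/-- One-sided **Barbalat lemma**: if `F` converges and `f ≤ F' + o(1)` with `f'` bounded below,
then `limsup f ≤ 0`. -/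
theorem eventually_lt_of_le_deriv {F F' f f' r : ℝ → ℝ} {a M η : ℝ} (hη : 0 < η)
    (hFa : Tendsto F atTop (𝓝 a)) (hF : ∀ᶠ s in atTop, HasDerivAt F (F' s) s)
    (hf : ∀ᶠ s in atTop, HasDerivAt f (f' s) s) (hM : ∀ᶠ s in atTop, -M ≤ f' s)
    (hr : Tendsto r atTop (𝓝 0)) (hle : ∀ᶠ s in atTop, f s ≤ F' s + r s) :
    ∀ᶠ s in atTop, f s < η := by
  wlog hM0 : 0 < M generalizing M
  · exact this (M := 1) (hM.mono fun s hs => by linarith) one_pos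
  have hd : 0 < η / (2 * M) := by positivity
  -- over a window of length `d = η / (2M)` the function `F` would gain `η d / 4`
  set d := η / (2 * M) with hd_def
  obtain ⟨s₀, hs₀⟩ := eventually_atTop.1 (hF.and (hf.and (hM.and (hle.and
    (hr.eventually_lt_const (show (0 : ℝ) < η / 4 by positivity))))))
  have hdiff : Tendsto (fun s => F (s + d) - F s) atTop (𝓝 0) := by
    simpa using (hFa.comp (tendsto_atTop_add_const_right _ d tendsto_id)).sub hFa
  filter_upwards [hdiff.eventually_lt_const (show (0 : ℝ) < η / 4 * d by positivity),
    eventually_gt_atTop s₀] with s h1 h2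
  by_contra hcon
  push Not at hcon
  have hfm : MonotoneOn (fun x => f x + M * x) (Set.Ioi s₀) := by
    refine monotoneOn_of_hasDerivAt (f' := fun x => f' x + M * 1) isOpen_Ioi (convex_Ioi s₀)
      (fun x hx => (hs₀ x (le_of_lt hx)).2.1.add ((hasDerivAt_id x).const_mul M)) fun x hx => ?_
    have := (hs₀ x (le_of_lt hx)).2.2.1
    linarith
  have hFm : MonotoneOn (fun x => F x - η / 4 * x) (Set.Icc s (s + d)) := by
    refine monotoneOn_of_hasDerivWithinAt_nonneg (f' := fun x => F' x - η / 4 * 1)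
      (convex_Icc _ _) (fun x hx => ?_) (fun x hx => ?_) (fun x hx => ?_)
    · have := (hs₀ x (by linarith [hx.1])).1.continuousAt
      exact ((this.sub (continuousAt_const.mul continuousAt_id))).continuousWithinAt
    · rw [interior_Icc] at hx
      have := (hs₀ x (by linarith [hx.1])).1
      exact (this.sub ((hasDerivAt_id x).const_mul (η / 4))).hasDerivWithinAt
    · rw [interior_Icc] at hx
      obtain ⟨-, -, -, h4, h5⟩ := hs₀ x (by linarith [hx.1])
      have h6 := hfm (show s ∈ Set.Ioi s₀ from h2)
        (show x ∈ Set.Ioi s₀ from h2.trans hx.1) hx.1.le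
      simp only at h6
      have h7 : M * (x - s) ≤ η / 2 := by
        calc M * (x - s) ≤ M * d := by
              apply mul_le_mul_of_nonneg_left _ hM0.le
              linarith [hx.2]
          _ = η / 2 := by rw [hd_def]; field_simp
      linarith
  have := hFm (Set.left_mem_Icc.2 (by linarith)) (Set.right_mem_Icc.2 (by linarith))
    (by linarith)
  simp only at this
  linarith

/-! ### The asymptotically autonomous phase plane -/

/-- The planar system `p' = p(1 - p) - X + K H²`, `H' = H(1 - 2p)` near `s = +∞`, with `p`, `X`,
`H` positive and `H → 0`. In the application `s = ln w`, `p = -λ₁ H`, `H = y² w` and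
`X = k n⁻¹ ρ H²`. The evolution of `X` is prescribed separately in each lemma that needs it. -/
structure PhaseFlow (K : ℝ) (p X H : ℝ → ℝ) : Prop where
  K_nonneg : 0 ≤ K
  p_deriv : ∀ᶠ s in atTop, HasDerivAt p (p s * (1 - p s) - X s + K * H s ^ 2) s
  H_deriv : ∀ᶠ s in atTop, HasDerivAt H (H s * (1 - 2 * p s)) s
  p_pos : ∀ᶠ s in atTop, 0 < p s
  X_pos : ∀ᶠ s in atTop, 0 < X s
  H_pos : ∀ᶠ s in atTop, 0 < H s
  H_tendsto : Tendsto H atTop (𝓝 0)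

namespace PhaseFlow

variable {K : ℝ} {p X H : ℝ → ℝ}

theorem tendsto_forcing (h : PhaseFlow K p X H) :
    Tendsto (fun s => K * H s ^ 2) atTop (𝓝 0) := by
  simpa using (h.H_tendsto.pow 2).const_mul K

/-- `H` has to decay, hence `p` exceeds `1 / 2` at arbitrarily large times. -/
theorem frequently_half_lt (h : PhaseFlow K p X H) : ∃ᶠ s in atTop, 1 / 2 < p s := by
  intro hcon
  have hle : ∀ᶠ s in atTop, p s ≤ 1 / 2 := hcon.mono fun s hs => not_lt.1 hs
  have hmono := eventually_eventually_le_of_deriv_nonneg h.H_deriv (by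
    filter_upwards [hle, h.H_pos] with s h1 h2
    exact mul_nonneg h2.le (by linarith))
  obtain ⟨s, h1, h2⟩ := (hmono.and h.H_pos).exists
  obtain ⟨t, h3, h4⟩ := (h1.and (h.H_tendsto.eventually_lt_const h2)).exists
  linarith

/-- If `X` stays above `1 / 4` then `p` is driven below zero. -/
theorem not_eventually_quarter_lt (h : PhaseFlow K p X H) {c : ℝ} (hc : 0 < c) :
    ¬ ∀ᶠ s in atTop, 1 / 4 + c ≤ X s := by
  intro hX
  have : ∀ᶠ s in atTop, p s ≤ 0 := by
    refine eventually_le_of_deriv_le (half_pos hc) h.p_deriv ?_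
    filter_upwards [hX, h.tendsto_forcing.eventually_lt_const (half_pos hc)] with s h1 h2 _
    nlinarith [sq_nonneg (p s - 1 / 2)]
  obtain ⟨s, h1, h2⟩ := (this.and h.p_pos).exists
  linarith

theorem not_tendsto_atTop (h : PhaseFlow K p X H) : ¬ Tendsto X atTop atTop := fun hX =>
  h.not_eventually_quarter_lt one_pos (hX.eventually_ge_atTop _)

theorem le_quarter_of_tendsto (h : PhaseFlow K p X H) {x : ℝ} (hX : Tendsto X atTop (𝓝 x)) :
    x ≤ 1 / 4 := by
  by_contra hcon
  push Not at hcon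
  refine h.not_eventually_quarter_lt (c := (x - 1 / 4) / 2) (by linarith) ?_
  filter_upwards [hX.eventually_const_lt (show 1 / 4 + (x - 1 / 4) / 2 < x by linarith)] with s hs
    using hs.le

/-- If `X` has a limit `x < 1 / 4` then `p` tends to the larger root of `p(1 - p) = x`. The smaller
root would make `H` grow. -/
theorem tendsto_of_tendsto (h : PhaseFlow K p X H) {x : ℝ} (hx : x < 1 / 4)
    (hX : Tendsto X atTop (𝓝 x)) : Tendsto p atTop (𝓝 (1 / 2 + √(1 / 4 - x))) := by
  have hr0 : 0 < √(1 / 4 - x) := Real.sqrt_pos.2 (by linarith)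
  have hr2 : √(1 / 4 - x) ^ 2 = 1 / 4 - x := Real.sq_sqrt (by linarith)
  set r := √(1 / 4 - x)
  have herr : Tendsto (fun s => -(X s - x) + K * H s ^ 2) atTop (𝓝 0) := by
    simpa using ((hX.sub_const x).neg).add h.tendsto_forcing
  have hhalf : ∀ᶠ s in atTop, 1 / 2 ≤ p s := by
    refine eventually_ge_of_barrier h.p_deriv ?_ (h.frequently_half_lt.mono fun s hs => hs.le)
    filter_upwards [herr.eventually_const_lt (show -(r ^ 2) < 0 by nlinarith)] with s h1 h2
    rw [h2]
    linarith
  have key : ∀ η > 0, ∀ᶠ s in atTop, 1 / 2 + r - η ≤ p s ∧ p s ≤ 1 / 2 + r + η := by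
    intro η hη
    have hc : 0 < η * r / 2 := by positivity
    refine Eventually.and ?_ ?_
    · refine eventually_ge_of_deriv_ge hc h.p_deriv ?_
      filter_upwards [hhalf, herr.eventually_const_lt (neg_lt_zero.2 hc)] with s h1 h2 h3
      have : η * r ≤ (1 / 2 + r - p s) * (p s - 1 / 2 + r) :=
        mul_le_mul (by linarith) (by linarith) hr0.le (by linarith)
      nlinarith
    · refine eventually_le_of_deriv_le hc h.p_deriv ?_
      filter_upwards [hhalf, herr.eventually_lt_const hc] with s h1 h2 h3
      have : η * r ≤ (p s - 1 / 2 - r) * (p s - 1 / 2 + r) :=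
        mul_le_mul (by linarith) (by linarith) hr0.le (by linarith)
      nlinarith
  refine tendsto_order.2 ⟨fun a ha => ?_, fun a ha => ?_⟩
  · filter_upwards [key ((1 / 2 + r - a) / 2) (by linarith)] with s hs
    linarith [hs.1]
  · filter_upwards [key ((a - (1 / 2 + r)) / 2) (by linarith)] with s hs
    linarith [hs.2]

theorem eventually_p_le_two (h : PhaseFlow K p X H) : ∀ᶠ s in atTop, p s ≤ 2 := by
  refine eventually_le_of_deriv_le one_pos h.p_deriv ?_
  filter_upwards [h.X_pos, h.tendsto_forcing.eventually_lt_const one_pos] with s h1 h2 h3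
  nlinarith

/-- In the critical case `X → 1 / 4` from below, exponentially fast, `(p - 1/2) / √H` increases to
a positive limit. The function `τ` is the original time. -/
theorem exists_tendsto_div_sqrt (h : PhaseFlow K p X H) {τ : ℝ → ℝ} {C D b : ℝ}
    (hτ : ∀ᶠ s in atTop, HasDerivAt τ (H s) s) (hτb : Tendsto τ atTop (𝓝 b))
    (hX : ∀ᶠ s in atTop, X s ≤ 1 / 4) (hXD : ∀ᶠ s in atTop, 1 / 4 - X s ≤ D * Real.exp (-s))
    (hH : ∀ᶠ s in atTop, Real.exp (-s) ≤ C * H s) :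
    ∃ a > 0, Tendsto (fun s => (p s - 1 / 2) / √(H s)) atTop (𝓝 a) := by
  set G : ℝ → ℝ := fun s => (p s - 1 / 2) / √(H s)
  have hG : ∀ᶠ s in atTop,
      HasDerivAt G ((1 / 4 - X s + K * H s ^ 2) / √(H s)) s := by
    filter_upwards [h.p_deriv, h.H_deriv, h.H_pos] with s h1 h2 h3
    have hs : √(H s) ^ 2 = H s := Real.sq_sqrt h3.le
    have hs0 : √(H s) ≠ 0 := (Real.sqrt_pos.2 h3).ne'
    refine ((h1.sub_const (1 / 2)).div (h2.sqrt h3.ne') hs0).congr_deriv ?_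
    rw [hs]
    field_simp
    rw [hs]
    ring
  have hG0 : ∀ᶠ s in atTop, 0 ≤ (1 / 4 - X s + K * H s ^ 2) / √(H s) := by
    filter_upwards [hX] with s h1
    have := h.K_nonneg
    exact div_nonneg (by nlinarith [mul_nonneg this (sq_nonneg (H s))]) (Real.sqrt_nonneg _)
  have hmono := eventually_eventually_le_of_deriv_nonneg hG hG0
  obtain ⟨s₁, h0, h1, h3⟩ := (h.frequently_half_lt.and_eventually (hmono.and h.H_pos)).exists
  have hpos : 0 < G s₁ := div_pos (by linarith) (Real.sqrt_pos.2 h3)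
  have hprim : ∀ᶠ s in atTop, HasDerivAt
      (fun s => K * τ s + (|D| * √|C|) * (-2 * Real.exp (-s / 2)))
      (K * H s + (|D| * √|C|) * Real.exp (-s / 2)) s := by
    filter_upwards [hτ] with s hs
    have he : HasDerivAt (fun s : ℝ => -2 * Real.exp (-s / 2)) (Real.exp (-s / 2)) s := by
      refine ((((hasDerivAt_id s).neg.div_const 2).exp).const_mul (-2)).congr_deriv ?_
      change -2 * (Real.exp (-s / 2) * (-1 / 2)) = _
      ring
    exact (hs.const_mul K).add (he.const_mul _)
  have hlim : Tendsto (fun s => K * τ s + (|D| * √|C|) * (-2 * Real.exp (-s / 2))) atTop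
      (𝓝 (K * b + (|D| * √|C|) * (-2 * 0))) := by
    refine (hτb.const_mul K).add ((Tendsto.const_mul _ ?_).const_mul _)
    refine Real.tendsto_exp_atBot.comp ?_
    exact (tendsto_neg_atTop_atBot.atBot_div_const two_pos)
  obtain ⟨a, ha⟩ := exists_tendsto_of_deriv_le hG hprim (M := G s₁) (by
    filter_upwards [hXD, hH, h.H_pos, h.H_tendsto.eventually_lt_const one_pos, hX]
      with s h4 h5 h6 h7 h8
    have hs : √(H s) ^ 2 = H s := Real.sq_sqrt h6.le
    have hs0 : 0 < √(H s) := Real.sqrt_pos.2 h6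
    have hs1 : √(H s) ≤ 1 := Real.sqrt_le_one.2 h7.le
    have he : Real.exp (-s) = Real.exp (-s / 2) * Real.exp (-s / 2) := by
      rw [← Real.exp_add]; ring_nf
    have hee := Real.exp_pos (-s / 2)
    have h9 : Real.exp (-s / 2) ≤ √|C| * √(H s) := by
      rw [← Real.sqrt_mul (abs_nonneg C)]
      refine Real.le_sqrt_of_sq_le ?_
      rw [sq, ← he]
      exact h5.trans (mul_le_mul_of_nonneg_right (le_abs_self C) h6.le)
    have h10 : D * Real.exp (-s) ≤ |D| * √|C| * Real.exp (-s / 2) * √(H s) := by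
      calc D * Real.exp (-s) ≤ |D| * Real.exp (-s) :=
            mul_le_mul_of_nonneg_right (le_abs_self D) (Real.exp_pos _).le
        _ = |D| * Real.exp (-s / 2) * Real.exp (-s / 2) := by rw [he]; ring
        _ ≤ |D| * Real.exp (-s / 2) * (√|C| * √(H s)) :=
            mul_le_mul_of_nonneg_left h9 (mul_nonneg (abs_nonneg D) hee.le)
        _ = _ := by ring
    have h11 : K * H s ^ 2 ≤ K * H s * √(H s) := by
      have : H s ^ 2 ≤ H s * √(H s) := by nlinarith
      nlinarith [mul_le_mul_of_nonneg_left this h.K_nonneg]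
    rw [div_le_iff₀ hs0]
    nlinarith) hlim h1
  exact ⟨a, hpos.trans_le (ge_of_tendsto ha h1), ha⟩

/-- If the logarithmic derivative of `X` is at least `N (p - 1/2)`, an energy estimate bounds
`1 / H`, against `H → 0`. With `g = H ^ (-1/2)` one has `g'' = (1/4 - X + K g⁻⁴) g`, where `X` is
`g ^ N` times a nondecreasing weight; the energy is divided by the weight and evaluated at times
where `g` attains its running maximum. -/
theorem not_growing_weight (h : PhaseFlow K p X H) {N : ℝ} (hN : 0 < N) {γ : ℝ → ℝ}
    (hγ : ∀ᶠ s in atTop, 0 ≤ γ s)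
    (hX : ∀ᶠ s in atTop, HasDerivAt X (X s * (N * (p s - 1 / 2) + γ s)) s) : False := by
  set L : ℝ → ℝ := fun s => H s ^ (-(N / 2)) with hLdef
  set S : ℝ → ℝ := fun s => L s / X s
  set A : ℝ → ℝ := fun s => (H s)⁻¹ * ((p s - 1 / 2) ^ 2 - 1 / 4 + K * H s ^ 2)
  set V : ℝ → ℝ := fun s => (H s)⁻¹ * L s
  have hL : ∀ᶠ s in atTop, HasDerivAt L (L s * (N * (p s - 1 / 2))) s := by
    filter_upwards [h.H_deriv, h.H_pos] with s h1 h2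
    refine (h1.rpow_const (p := -(N / 2)) (Or.inl h2.ne')).congr_deriv ?_
    rw [Real.rpow_sub_one h2.ne', hLdef]
    field_simp
    ring
  have hS : ∀ᶠ s in atTop, HasDerivAt S (-γ s * S s) s := by
    filter_upwards [hL, hX, h.X_pos] with s h1 h2 h3
    refine (h1.div h2 h3.ne').congr_deriv ?_
    simp only [S]
    field_simp
    ring
  have hA : ∀ᶠ s in atTop, HasDerivAt A (-2 * (p s - 1 / 2) * X s * (H s)⁻¹) s := by
    filter_upwards [h.H_deriv, h.H_pos, h.p_deriv] with s h1 h2 h3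
    refine ((h1.inv h2.ne').mul ((((h3.sub_const (1 / 2)).pow 2).sub_const (1 / 4)).add
      ((h1.pow 2).const_mul K))).congr_deriv ?_
    simp only [Pi.pow_apply, Pi.inv_apply, Pi.add_apply]
    field_simp
    ring
  have hV : ∀ᶠ s in atTop, HasDerivAt V ((N + 2) * (p s - 1 / 2) * V s) s := by
    filter_upwards [h.H_deriv, h.H_pos, hL] with s h1 h2 h3
    refine ((h1.inv h2.ne').mul h3).congr_deriv ?_
    simp only [V, Pi.inv_apply]
    field_simp
    ring
  obtain ⟨s₀, hs₀⟩ := eventually_atTop.1 (hS.and (hA.and (hV.and (h.X_pos.and (h.H_pos.and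
    (hγ.and (h.H_deriv)))))))
  have hS0 : ∀ s ≥ s₀, 0 < S s := fun s hs => by
    obtain ⟨-, -, -, h4, h5, -⟩ := hs₀ s hs
    exact div_pos (Real.rpow_pos_of_pos h5 _) h4
  have hUtop : Tendsto (fun s => (H s)⁻¹) atTop atTop :=
    tendsto_inv_nhdsGT_zero.comp (tendsto_nhdsWithin_iff.2 ⟨h.H_tendsto, h.H_pos⟩)
  have hmain : ∀ M : ℝ, ∃ m ≥ M, 2 / (N + 2) * m ^ (N / 2) * m ≤
      S s₀ * A s₀ + 2 / (N + 2) * V s₀ + m / 4 * S s₀ := by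
    intro M
    obtain ⟨s₂, h1, h2⟩ := ((hUtop.eventually_ge_atTop M).and (eventually_ge_atTop s₀)).exists
    obtain ⟨s₁, hs1, hmax⟩ := isCompact_Icc.exists_isMaxOn (Set.nonempty_Icc.2 h2)
      (f := fun s => (H s)⁻¹) (fun s hs => by
        obtain ⟨-, -, -, h4, h5, -, h7⟩ := hs₀ s hs.1
        exact (h7.continuousAt.inv₀ h5.ne').continuousWithinAt)
    refine ⟨(H s₁)⁻¹, h1.trans (hmax (Set.right_mem_Icc.2 h2)), ?_⟩
    set m := (H s₁)⁻¹
    -- the weighted energy, corrected by `m / 4` times the reciprocal weight, decreases while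
    -- `1 / H ≤ m`
    have hanti : AntitoneOn (fun s => S s * A s + 2 / (N + 2) * V s + m / 4 * S s)
        (Set.Icc s₀ s₁) := by
      have hd : ∀ s ≥ s₀, HasDerivAt (fun s => S s * A s + 2 / (N + 2) * V s + m / 4 * S s)
        (-(γ s * S s * (A s + m / 4))) s := by
        intro s hs
        obtain ⟨h1, h2, h3, h4, h5, -⟩ := hs₀ s hs
        refine (((h1.mul h2).add (h3.const_mul _)).add (h1.const_mul (m / 4))).congr_deriv ?_
        simp only [S, V]
        field_simp
        ring
      refine antitoneOn_of_hasDerivWithinAt_nonpos (convex_Icc _ _)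
        (fun s hs => (hd s hs.1).continuousAt.continuousWithinAt)
        (fun s hs => (hd s (interior_subset hs).1).hasDerivWithinAt) (fun s hs => ?_)
      have hs' := interior_subset hs
      obtain ⟨-, -, -, h4, h5, h6, -⟩ := hs₀ s hs'.1
      have hm : (H s)⁻¹ ≤ m := hmax ⟨hs'.1, hs'.2.trans hs1.2⟩
      have hA' : 0 ≤ A s + m / 4 := by
        have h8 : 0 ≤ (H s)⁻¹ * ((p s - 1 / 2) ^ 2 + K * H s ^ 2) :=
          mul_nonneg (inv_nonneg.2 h5.le) (add_nonneg (sq_nonneg _)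
            (mul_nonneg h.K_nonneg (sq_nonneg _)))
        have : A s = (H s)⁻¹ * ((p s - 1 / 2) ^ 2 + K * H s ^ 2) - (H s)⁻¹ / 4 := by
          simp only [A]; ring
        linarith
      exact neg_nonpos.2 (mul_nonneg (mul_nonneg h6 (hS0 s hs'.1).le) hA')
    refine le_trans ?_ (hanti (Set.left_mem_Icc.2 hs1.1) (Set.right_mem_Icc.2 hs1.1) hs1.1)
    obtain ⟨-, -, -, h4, h5, -⟩ := hs₀ s₁ hs1.1
    have hV1 : V s₁ = m ^ (N / 2) * m := by
      simp only [V, L, m]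
      rw [Real.inv_rpow h5.le, Real.rpow_neg h5.le]
      ring
    have hA1 : 0 ≤ A s₁ + m / 4 := by
      have h8 : 0 ≤ (H s₁)⁻¹ * ((p s₁ - 1 / 2) ^ 2 + K * H s₁ ^ 2) :=
          mul_nonneg (inv_nonneg.2 h5.le) (add_nonneg (sq_nonneg _)
            (mul_nonneg h.K_nonneg (sq_nonneg _)))
      have : A s₁ = (H s₁)⁻¹ * ((p s₁ - 1 / 2) ^ 2 + K * H s₁ ^ 2) - m / 4 := by
        simp only [A, m]; ring
      linarith
    have := mul_nonneg (hS0 s₁ hs1.1).le hA1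
    simp only [hV1]
    linarith
  have hpow : Tendsto (fun m : ℝ => 2 / (N + 2) * m ^ (N / 2)) atTop atTop :=
    (tendsto_rpow_atTop (half_pos hN)).const_mul_atTop (by positivity)
  obtain ⟨M, hM⟩ := eventually_atTop.1 (((hpow.eventually_gt_atTop
    (|S s₀ * A s₀ + 2 / (N + 2) * V s₀| + S s₀ / 4))).and (eventually_ge_atTop 1))
  obtain ⟨m, hm, hle⟩ := hmain M
  obtain ⟨h1, h2⟩ := hM m hm
  have h3 := le_abs_self (S s₀ * A s₀ + 2 / (N + 2) * V s₀)
  have h4 := abs_nonneg (S s₀ * A s₀ + 2 / (N + 2) * V s₀)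
  have h5 := mul_lt_mul_of_pos_right h1 (one_pos.trans_le h2)
  nlinarith

/-- A rise of `X` above a fixed level would push `p` below zero within one unit of time. -/
theorem isBigO_one_of_deriv_ge (h : PhaseFlow K p X H) {C : ℝ} {X' : ℝ → ℝ} (hC : 0 ≤ C)
    (hX : ∀ᶠ s in atTop, HasDerivAt X (X' s) s) (hX' : ∀ᶠ s in atTop, -(C * X s) ≤ X' s) :
    X =O[atTop] fun _ => (1 : ℝ) := by
  obtain ⟨s₀, hs₀⟩ := eventually_atTop.1 (hX.and (hX'.and (h.X_pos.and (h.p_pos.and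
    (h.eventually_p_le_two.and (h.p_deriv.and (h.tendsto_forcing.eventually_lt_const one_pos)))))))
  refine IsBigO.of_bound (6 * Real.exp C) ?_
  filter_upwards [eventually_gt_atTop s₀] with s hs
  have hXs := (hs₀ s hs.le).2.2.1
  rw [Real.norm_of_nonneg hXs.le, norm_one, mul_one]
  by_contra hcon
  push Not at hcon
  have hmono : MonotoneOn (fun x => X x * Real.exp (C * x)) (Set.Ioi s₀) := by
    refine monotoneOn_of_hasDerivAt (f' := fun x => (X' x + C * X x) * Real.exp (C * x)) isOpen_Ioi
      (convex_Ioi _) (fun x hx => ?_) (fun x hx => ?_)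
    · refine ((hs₀ x (le_of_lt hx)).1.mul (((hasDerivAt_id x).const_mul C).exp)).congr_deriv ?_
      simp only [id]
      ring
    · have := (hs₀ x (le_of_lt hx)).2.1
      exact mul_nonneg (by linarith) (Real.exp_pos _).le
  have hlow : ∀ x ∈ Set.Icc s (s + 1), 6 ≤ X x := by
    intro x hx
    have h1 := hmono (show s ∈ Set.Ioi s₀ from hs) (show x ∈ Set.Ioi s₀ from hs.trans_le hx.1) hx.1
    simp only at h1
    have h2 : Real.exp (C * x) ≤ Real.exp C * Real.exp (C * s) := by
      rw [← Real.exp_add]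
      exact Real.exp_le_exp.2 (by nlinarith [hx.2])
    have h3 := Real.exp_pos (C * s)
    have h5 := (hs₀ x (by linarith [hx.1])).2.2.1
    have h4 : 6 * Real.exp (C * x) ≤ X x * Real.exp (C * x) := by
      nlinarith [mul_lt_mul_of_pos_right hcon h3]
    exact le_of_mul_le_mul_right h4 (Real.exp_pos _)
  have hanti : AntitoneOn (fun x => p x + 4 * x) (Set.Icc s (s + 1)) := by
    have hd : ∀ x ∈ Set.Icc s (s + 1), HasDerivAt (fun x => p x + 4 * x)
        (p x * (1 - p x) - X x + K * H x ^ 2 + 4 * 1) x := fun x hx =>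
      (hs₀ x (by linarith [hx.1])).2.2.2.2.2.1.add ((hasDerivAt_id x).const_mul 4)
    refine antitoneOn_of_hasDerivWithinAt_nonpos (convex_Icc _ _)
      (fun x hx => (hd x hx).continuousAt.continuousWithinAt)
      (fun x hx => (hd x (interior_subset hx)).hasDerivWithinAt) (fun x hx => ?_)
    have h1 := hlow x (interior_subset hx)
    have h2 := (hs₀ x (by linarith [(interior_subset hx).1])).2.2.2.2.2.2
    nlinarith [sq_nonneg (p x - 1 / 2)]
  have h1 := hanti (Set.left_mem_Icc.2 (by linarith)) (Set.right_mem_Icc.2 (by linarith))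
    (show s ≤ s + 1 by linarith)
  have h2 := (hs₀ s hs.le).2.2.2.2.1
  have h3 := (hs₀ (s + 1) (by linarith)).2.2.2.1
  simp only at h1
  linarith

/-- The supercritical case. In the unknown `b = X ^ (1 / N)` the system is a damped oscillator with
a double-well potential, up to integrable perturbations. The energy gives `b' → 0` and then
`b (β (1 - β) - X) → 0`, and the equilibrium `X = 0` is excluded since there `p → 1 > β`. -/
theorem tendsto_of_damped (h : PhaseFlow K p X H) {N β D B : ℝ} {τ δ : ℝ → ℝ} (hN : 0 < N)
    (hβ : 1 / 2 < β) (hβ1 : β < 1)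
    (hτ : ∀ᶠ s in atTop, HasDerivAt τ (H s) s) (hτB : ∀ᶠ s in atTop, τ s ≤ B)
    (hδ0 : ∀ᶠ s in atTop, 0 ≤ δ s) (hδ : ∀ᶠ s in atTop, δ s ≤ D * Real.exp (-s))
    (hX : ∀ᶠ s in atTop, HasDerivAt X (X s * (N * (p s - β) + δ s)) s) :
    Tendsto X atTop (𝓝 (β * (1 - β))) := by
  have hone : ∀ {u v : ℝ → ℝ}, u =O[atTop] (fun _ => (1 : ℝ)) → v =O[atTop] (fun _ => (1 : ℝ)) →
      (fun s => u s * v s) =O[atTop] (fun _ => (1 : ℝ)) := fun hu hv => by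
    simpa using hu.mul hv
  have hzero : ∀ {u v : ℝ → ℝ}, u =O[atTop] (fun _ => (1 : ℝ)) → Tendsto v atTop (𝓝 0) →
      Tendsto (fun s => u s * v s) atTop (𝓝 0) := fun hu hv => by
    have := hu.mul_isLittleO ((isLittleO_one_iff ℝ).2 hv)
    simpa using this
  have hconst : ∀ c : ℝ, (fun _ : ℝ => c) =O[atTop] (fun _ => (1 : ℝ)) := fun c =>
    isBigO_const_const c one_ne_zero _
  set x := β * (1 - β) with hx
  have hx0 : 0 < x := mul_pos (by linarith) (by linarith)
  have hpB : p =O[atTop] fun _ => (1 : ℝ) := by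
    refine IsBigO.of_bound 2 ?_
    filter_upwards [h.p_pos, h.eventually_p_le_two] with s h1 h2
    rw [Real.norm_of_nonneg h1.le, norm_one, mul_one]
    exact h2
  have hXB : X =O[atTop] fun _ => (1 : ℝ) := by
    refine h.isBigO_one_of_deriv_ge (C := N * β) (by positivity) hX ?_
    filter_upwards [h.X_pos, h.p_pos, hδ0] with s h1 h2 h3
    have := mul_nonneg h1.le (add_nonneg (mul_nonneg hN.le h2.le) h3)
    linarith
  have hδ' : Tendsto δ atTop (𝓝 0) := by
    refine squeeze_zero' hδ0 hδ ?_
    simpa using (Real.tendsto_exp_neg_atTop_nhds_zero).const_mul D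
  have hδB : δ =O[atTop] fun _ => (1 : ℝ) := hδ'.isBigO_one ℝ
  set e : ℝ → ℝ := fun s => K * H s ^ 2
  have he : Tendsto e atTop (𝓝 0) := h.tendsto_forcing
  have heB : e =O[atTop] fun _ => (1 : ℝ) := he.isBigO_one ℝ
  set b : ℝ → ℝ := fun s => X s ^ (1 / N)
  have hbB : b =O[atTop] fun _ => (1 : ℝ) := by
    have := hXB.rpow (r := 1 / N) (by positivity) (Eventually.of_forall fun _ => zero_le_one)
    simpa only [Real.one_rpow] using this
  set π : ℝ → ℝ := fun s => p s - β
  have hπB : π =O[atTop] fun _ => (1 : ℝ) := hpB.sub (hconst β)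
  set b' : ℝ → ℝ := fun s => b s * (π s + δ s * (1 / N))
  set π' : ℝ → ℝ := fun s => (1 - 2 * β) * π s - π s * π s + (x - X s) + e s
  set X' : ℝ → ℝ := fun s => X s * (N * π s + δ s)
  have hbd : ∀ᶠ s in atTop, HasDerivAt b (b' s) s := by
    filter_upwards [hX, h.X_pos] with s h1 h2
    refine (h1.rpow_const (p := 1 / N) (Or.inl h2.ne')).congr_deriv ?_
    rw [Real.rpow_sub_one h2.ne']
    simp only [b', b, π]
    field_simp
  have hπd : ∀ᶠ s in atTop, HasDerivAt π (π' s) s := by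
    filter_upwards [h.p_deriv] with s h1
    refine (h1.sub_const β).congr_deriv ?_
    simp only [π', π, e, hx]
    ring
  have hb'B : b' =O[atTop] fun _ => (1 : ℝ) := hone hbB (hπB.add (hone hδB (hconst _)))
  have hXxB : (fun s => x - X s) =O[atTop] fun _ => (1 : ℝ) := (hconst x).sub hXB
  have hπ'B : π' =O[atTop] fun _ => (1 : ℝ) :=
    (((hone (hconst _) hπB).sub (hone hπB hπB)).add hXxB).add heB
  have hX'B : X' =O[atTop] fun _ => (1 : ℝ) := hone hXB ((hone (hconst N) hπB).add hδB)
  -- the energy and its dissipation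
  set E : ℝ → ℝ := fun s => b s * b s * (π s * π s * (1 / 2) - x / 2 + X s * (1 / (N + 2)))
  have hEB : E =O[atTop] fun _ => (1 : ℝ) := hone (hone hbB hbB)
    (((hone (hone hπB hπB) (hconst _)).sub (hconst _)).add (hone hXB (hconst _)))
  set W : ℝ → ℝ := fun s => b s * b s *
    ((π s * π s * (1 / 2) - x / 2 + X s * (1 / (N + 2))) * (2 * (1 / N)) + X s * (1 / (N + 2)))
  have hWB : W =O[atTop] fun _ => (1 : ℝ) := hone (hone hbB hbB)
    ((hone ((((hone (hone hπB hπB) (hconst _)).sub (hconst _)).add (hone hXB (hconst _))))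
      (hconst _)).add (hone hXB (hconst _)))
  set Z : ℝ → ℝ := fun s => b s * b s * π s
  have hZB : Z =O[atTop] fun _ => (1 : ℝ) := hone (hone hbB hbB) hπB
  have hEd : ∀ᶠ s in atTop, HasDerivAt E
      (-((2 * β - 1) * (b s * π s * (b s * π s))) + Z s * e s + W s * δ s) s := by
    filter_upwards [hbd, hπd, hX] with s h1 h2 h3
    refine ((h1.mul h1).mul ((((h2.mul h2).mul_const (1 / 2)).sub_const (x / 2)).add
      (h3.mul_const (1 / (N + 2))))).congr_deriv ?_
    simp only [b', π', Z, W, π, Pi.mul_apply, Pi.add_apply]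
    field_simp
    ring
  obtain ⟨C₁, hC₁⟩ := hZB.bound
  obtain ⟨C₂, hC₂⟩ := hWB.bound
  set f : ℝ → ℝ := fun s => (2 * β - 1) * (b s * π s * (b s * π s))
  set G : ℝ → ℝ := fun s => E s - |C₁| * K * τ s + |C₂| * D * Real.exp (-s)
  have hGd : ∀ᶠ s in atTop, HasDerivAt G (-f s + Z s * e s + W s * δ s - |C₁| * K * H s
      + |C₂| * D * -Real.exp (-s)) s := by
    filter_upwards [hEd, hτ] with s h1 h2
    have h3 : HasDerivAt (fun s : ℝ => Real.exp (-s)) (-Real.exp (-s)) s := by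
      simpa using (hasDerivAt_id s).neg.exp
    exact (h1.sub (h2.const_mul _)).add (h3.const_mul _)
  have hGle : ∀ᶠ s in atTop, -f s + Z s * e s + W s * δ s - |C₁| * K * H s
      + |C₂| * D * -Real.exp (-s) ≤ -f s := by
    filter_upwards [hC₁, hC₂, hδ0, hδ, h.H_pos, h.H_tendsto.eventually_lt_const one_pos]
      with s h1 h2 h3 h4 h5 h6
    have h7 : Z s ≤ |C₁| := by
      have := (le_abs_self (Z s)).trans h1
      rw [norm_one, mul_one] at this
      exact this.trans (le_abs_self _)
    have h8 : W s ≤ |C₂| := by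
      have := (le_abs_self (W s)).trans h2
      rw [norm_one, mul_one] at this
      exact this.trans (le_abs_self _)
    have h9 : e s ≤ K * H s := by
      simp only [e]
      exact mul_le_mul_of_nonneg_left (by nlinarith) h.K_nonneg
    have h10 : 0 ≤ e s := mul_nonneg h.K_nonneg (sq_nonneg _)
    have h11 : Z s * e s ≤ |C₁| * (K * H s) := mul_le_mul h7 h9 h10 (abs_nonneg _)
    have h12 : W s * δ s ≤ |C₂| * (D * Real.exp (-s)) := mul_le_mul h8 h4 h3 (abs_nonneg _)
    linarith
  have hf0 : ∀ s, 0 ≤ f s := fun s => mul_nonneg (by linarith) (mul_self_nonneg _)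
  obtain ⟨C₃, hC₃⟩ := hEB.bound
  obtain ⟨a, ha⟩ := exists_tendsto_of_deriv_le (g := fun _ => 0) (g' := fun _ => 0) (a := 0)
    (M := -|C₃| - |C₁| * K * B - |C₂| * |D|) hGd
    (Eventually.of_forall fun s => hasDerivAt_const s _)
    (hGle.mono fun s hs => hs.trans (neg_nonpos.2 (hf0 s))) tendsto_const_nhds (by
      filter_upwards [hC₃, hτB, eventually_ge_atTop 0] with s h1 h2 h3
      have h4 : -|C₃| ≤ E s := by
        rw [norm_one, mul_one, Real.norm_eq_abs] at h1
        exact (abs_le.1 (h1.trans (le_abs_self _))).1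
      have h5 : |C₁| * K * τ s ≤ |C₁| * K * B :=
        mul_le_mul_of_nonneg_left h2 (mul_nonneg (abs_nonneg _) h.K_nonneg)
      have h6 : -(|C₂| * |D|) ≤ |C₂| * D * Real.exp (-s) := by
        have h7 : Real.exp (-s) ≤ 1 := Real.exp_le_one_iff.2 (by linarith)
        have h8 : -|D| ≤ D * Real.exp (-s) := by
          have := mul_le_mul_of_nonneg_left h7 (abs_nonneg D)
          have h9 := mul_le_mul_of_nonneg_right (neg_abs_le D) (Real.exp_pos (-s)).le
          linarith
        have := mul_le_mul_of_nonneg_left h8 (abs_nonneg C₂)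
        linarith
      simp only [G]
      linarith)
  set q : ℝ → ℝ := fun s => b s * π s
  set q' : ℝ → ℝ := fun s => b' s * π s + b s * π' s
  have hqB : q =O[atTop] fun _ => (1 : ℝ) := hone hbB hπB
  have hq'B : q' =O[atTop] fun _ => (1 : ℝ) := (hone hb'B hπB).add (hone hbB hπ'B)
  have hqd : ∀ᶠ s in atTop, HasDerivAt q (q' s) s := by
    filter_upwards [hbd, hπd] with s h1 h2 using h1.mul h2
  have hlow : ∀ {u : ℝ → ℝ}, u =O[atTop] (fun _ => (1 : ℝ)) → ∃ M, ∀ᶠ s in atTop, -M ≤ u s := by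
    intro u hu
    obtain ⟨M, hM⟩ := hu.bound
    refine ⟨M, hM.mono fun s hs => ?_⟩
    rw [norm_one, mul_one, Real.norm_eq_abs] at hs
    exact (abs_le.1 hs).1
  have hq0 : Tendsto q atTop (𝓝 0) := by
    obtain ⟨M, hM⟩ := hlow (hone (hconst (2 * β - 1)) ((hone hq'B hqB).add (hone hqB hq'B)))
    have hq2 : Tendsto (fun s => q s ^ 2) atTop (𝓝 0) := by
      refine tendsto_order.2 ⟨fun c hc => Eventually.of_forall fun s =>
        hc.trans_le (sq_nonneg _), fun c hc => ?_⟩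
      have := eventually_lt_of_le_deriv (F := fun s => -G s) (f := f) (r := fun _ => 0)
        (η := (2 * β - 1) * c) (mul_pos (by linarith) hc) ha.neg
        (hGd.mono fun s hs => hs.neg) (hqd.mono fun s hs => (hs.mul hs).const_mul (2 * β - 1)) hM
        tendsto_const_nhds (hGle.mono fun s hs => by linarith)
      filter_upwards [this] with s hs
      have := lt_of_mul_lt_mul_left hs (by linarith)
      simpa [sq] using this
    have := hq2.sqrt
    simp only [Real.sqrt_sq_eq_abs, Real.sqrt_zero] at this
    exact (tendsto_zero_iff_abs_tendsto_zero q).2 this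
  -- second use of the Barbalat argument, now for `q' = b (x - X) + o(1)`
  set g : ℝ → ℝ := fun s => b s * (x - X s)
  have hgd : ∀ᶠ s in atTop, HasDerivAt g (b' s * (x - X s) + b s * -X' s) s := by
    filter_upwards [hbd, hX] with s h1 h2 using h1.mul (h2.const_sub x)
  have hg'B : (fun s => b' s * (x - X s) + b s * -X' s) =O[atTop] fun _ => (1 : ℝ) :=
    (hone hb'B hXxB).add (hone hbB hX'B.neg_left)
  have hr : Tendsto (fun s => g s - q' s) atTop (𝓝 0) := by
    have h3 := (((hzero (hone hbB hπB) hδ').mul_const (1 / N)).add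
      (hq0.const_mul (1 - 2 * β))).add (hzero hbB he)
    replace h3 := h3.neg
    rw [zero_mul, mul_zero, add_zero, add_zero, neg_zero] at h3
    refine h3.congr fun s => ?_
    simp only [g, q', b', π', q]
    ring
  have hg0 : Tendsto g atTop (𝓝 0) := by
    obtain ⟨M₁, hM₁⟩ := hlow hg'B
    obtain ⟨M₂, hM₂⟩ := hlow hg'B.neg_left
    refine tendsto_order.2 ⟨fun c hc => ?_, fun c hc => ?_⟩
    · have := eventually_lt_of_le_deriv (F := fun s => -q s) (f := fun s => -g s)
        (r := fun s => -(g s - q' s)) (neg_pos.2 hc) hq0.neg (hqd.mono fun s hs => hs.neg)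
        (hgd.mono fun s hs => hs.neg) hM₂ (by simpa using hr.neg)
        (Eventually.of_forall fun s => by linarith)
      exact this.mono fun s hs => neg_lt_neg_iff.1 hs
    · exact eventually_lt_of_le_deriv hc hq0 hqd hgd hM₁ hr
        (Eventually.of_forall fun s => by linarith)
  -- `X` avoids the level `x / 2`, where `g` is bounded away from zero
  set c := (x / 2) ^ (1 / N)
  have hc0 : 0 < c := Real.rpow_pos_of_pos (half_pos hx0) _
  have hne : ∀ᶠ s in atTop, X s ≠ x / 2 := by
    filter_upwards [hg0.eventually_lt_const (show 0 < c * (x / 2) by positivity)] with s hs heq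
    simp only [g, b, heq] at hs
    change c * (x - x / 2) < _ at hs
    linarith
  obtain ⟨s₁, hs₁⟩ := eventually_atTop.1 (hne.and hX)
  have hcont : ContinuousOn X (Set.Ici s₁) := fun s hs =>
    (hs₁ s hs).2.continuousAt.continuousWithinAt
  have hdich : (∀ s ≥ s₁, x / 2 < X s) ∨ (∀ s ≥ s₁, X s < x / 2) := by
    by_contra hcon
    push Not at hcon
    obtain ⟨⟨s, hs, hs'⟩, ⟨t, ht, ht'⟩⟩ := hcon
    obtain ⟨u, hu, hu'⟩ := (isPreconnected_Ici (a := s₁)).intermediate_value hs ht hcont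
      ⟨hs', ht'⟩
    exact (hs₁ u hu).1 hu'
  rcases hdich with hbig | hsmall
  · have h1 : Tendsto (fun s => x - X s) atTop (𝓝 0) := by
      refine squeeze_zero_norm' (a := fun s => |g s| / c) ?_ ?_
      · filter_upwards [eventually_ge_atTop s₁] with s hs
        rw [le_div_iff₀ hc0, Real.norm_eq_abs]
        simp only [g, abs_mul]
        rw [mul_comm]
        refine mul_le_mul_of_nonneg_right ?_ (abs_nonneg _)
        exact (Real.rpow_le_rpow (half_pos hx0).le (hbig s hs).le (by positivity)).trans
          (le_abs_self _)
      · simpa using hg0.abs.div_const c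
    simpa using (tendsto_const_nhds (x := x)).sub h1
  · exfalso
    have hb : Tendsto b atTop (𝓝 0) := by
      refine squeeze_zero_norm' (a := fun s => |g s| / (x / 2)) ?_ ?_
      · filter_upwards [eventually_ge_atTop s₁] with s hs
        rw [le_div_iff₀ (half_pos hx0), Real.norm_eq_abs]
        simp only [g, abs_mul]
        refine mul_le_mul_of_nonneg_left ?_ (abs_nonneg _)
        have := hsmall s hs
        exact le_trans (by linarith) (le_abs_self _)
      · simpa using hg0.abs.div_const (x / 2)
    have hX0 : Tendsto X atTop (𝓝 0) := by
      have h1 := hb.rpow_const (p := N) (Or.inr hN.le)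
      rw [Real.zero_rpow hN.ne'] at h1
      refine h1.congr' ?_
      filter_upwards [h.X_pos] with s hs
      simp only [b]
      rw [← Real.rpow_mul hs.le, one_div, inv_mul_cancel₀ hN.ne', Real.rpow_one]
    have hp1 := h.tendsto_of_tendsto (by norm_num) hX0
    have hroot : (1 / 2 + √(1 / 4 - 0) : ℝ) = 1 := by
      rw [show (1 / 4 - 0 : ℝ) = (1 / 2) ^ 2 by norm_num, Real.sqrt_sq (by norm_num)]
      norm_num
    rw [hroot] at hp1
    -- near `p = 1` the function `X` increases, so it cannot tend to zero
    have hmono := eventually_eventually_le_of_deriv_nonneg hX (by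
      filter_upwards [h.X_pos, hδ0, hp1.eventually_const_lt hβ1] with s h1 h2 h3
      exact mul_nonneg h1.le (add_nonneg (mul_nonneg hN.le (by linarith)) h2))
    obtain ⟨s, h1, h2⟩ := (hmono.and h.X_pos).exists
    obtain ⟨t, h3, h4⟩ := (h1.and (hX0.eventually_lt_const h2)).exists
    linarith

end PhaseFlow

/-! ### Change of the time variable -/

/-- A clock `σ` increasing to infinity at the finite time `b` has a differentiable inverse `T`. -/
theorem exists_inverse_clock {b : ℝ} {σ σ' : ℝ → ℝ}
    (hσ : ∀ᶠ t in 𝓝[<] b, HasDerivAt σ (σ' t) t) (hσ' : ∀ᶠ t in 𝓝[<] b, 0 < σ' t)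
    (htop : Tendsto σ (𝓝[<] b) atTop) :
    ∃ T : ℝ → ℝ, Tendsto T atTop (𝓝[<] b) ∧
      (∀ᶠ s in atTop, HasDerivAt T (σ' (T s))⁻¹ s) ∧
      (∀ᶠ s in atTop, σ (T s) = s) ∧ ∀ᶠ t in 𝓝[<] b, T (σ t) = t := by
  obtain ⟨a, ha, hab⟩ := mem_nhdsLT_iff_exists_Ioo_subset.1 (hσ.and hσ')
  have hσd : ∀ t ∈ Set.Ioo a b, HasDerivAt σ (σ' t) t := fun t ht => (hab ht).1
  have hmono : StrictMonoOn σ (Set.Ioo a b) := by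
    refine strictMonoOn_of_deriv_pos (convex_Ioo a b)
      (fun t ht => (hσd t ht).continuousAt.continuousWithinAt) fun t ht => ?_
    rw [interior_Ioo] at ht
    rw [(hσd t ht).deriv]
    exact (hab ht).2
  obtain ⟨t₁, hat, htb⟩ := exists_between (show a < b from ha)
  have hsub : Set.Ioo t₁ b ⊆ Set.Ioo a b := Set.Ioo_subset_Ioo_left hat.le
  have hex : ∀ s ∈ Set.Ioi (σ t₁), ∃ t ∈ Set.Ioo t₁ b, σ t = s := by
    intro s hs
    obtain ⟨t₂, h1, h2⟩ := ((htop.eventually_gt_atTop s).and (Ioo_mem_nhdsLT htb)).exists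
    obtain ⟨t, ht, hts⟩ := intermediate_value_Ioo h2.1.le (f := σ)
      (fun t ht => (hσd t ⟨hat.trans_le ht.1, ht.2.trans_lt h2.2⟩).continuousAt.continuousWithinAt)
      ⟨hs, h1⟩
    exact ⟨t, ⟨ht.1, ht.2.trans h2.2⟩, hts⟩
  choose! T hT hTσ using hex
  have hσT : ∀ t ∈ Set.Ioo t₁ b, T (σ t) = t := fun t ht => by
    have h1 : σ t ∈ Set.Ioi (σ t₁) := hmono ⟨hat, htb⟩ (hsub ht) ht.1
    exact hmono.injOn (hsub (hT _ h1)) (hsub ht) (hTσ _ h1)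
  have hTmono : StrictMonoOn T (Set.Ioi (σ t₁)) := fun s hs s' hs' hss' => by
    by_contra hcon
    have := hmono.monotoneOn (hsub (hT _ hs')) (hsub (hT _ hs)) (not_lt.1 hcon)
    rw [hTσ _ hs, hTσ _ hs'] at this
    linarith
  have himg : Set.Ioo t₁ b ⊆ T '' Set.Ioi (σ t₁) := fun t ht =>
    ⟨σ t, hmono ⟨hat, htb⟩ (hsub ht) ht.1, hσT t ht⟩
  refine ⟨T, ?_, ?_, ?_, ?_⟩
  · refine tendsto_nhdsWithin_iff.2 ⟨tendsto_order.2 ⟨fun c hc => ?_, fun c hc => ?_⟩, ?_⟩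
    · obtain ⟨d, hd1, hd2⟩ := exists_between (max_lt hc htb)
      have hd : d ∈ Set.Ioo t₁ b := ⟨(le_max_right _ _).trans_lt hd1, hd2⟩
      have hds : σ d ∈ Set.Ioi (σ t₁) := hmono ⟨hat, htb⟩ (hsub hd) hd.1
      filter_upwards [eventually_gt_atTop (σ d)] with s hs
      have := hTmono hds (show s ∈ Set.Ioi (σ t₁) from lt_trans hds hs) hs
      rw [hσT d hd] at this
      exact ((le_max_left _ _).trans_lt hd1).trans this
    · filter_upwards [eventually_gt_atTop (σ t₁)] with s hs using (hT s hs).2.trans hc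
    · filter_upwards [eventually_gt_atTop (σ t₁)] with s hs using (hT s hs).2
  · filter_upwards [eventually_gt_atTop (σ t₁)] with s hs
    have hcont : ContinuousAt T s := hTmono.continuousAt_of_image_mem_nhds (Ioi_mem_nhds hs)
      (mem_of_superset (Ioo_mem_nhds (hT s hs).1 (hT s hs).2) himg)
    exact HasDerivAt.of_local_left_inverse hcont (hσd _ (hsub (hT s hs)))
      (hab (hsub (hT s hs))).2.ne' ((eventually_gt_nhds hs).mono fun x hx => hTσ x hx)
  · filter_upwards [eventually_gt_atTop (σ t₁)] with s hs using hTσ s hs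
  · filter_upwards [Ioo_mem_nhdsLT htb] with t ht using hσT t ht

/-! ### Collapse of the smallest component -/

/-- The smallest component `l` of the flow, together with `y = exp ∫ l` and `w = ∫ y⁻²`, near a time
`b` at which `l → -∞` and `y → 0`. The factors `y (1 + aᵢ w)`, `i ∈ I`, are the analogues of `y` for
the components that start above the smallest one. -/
structure CollapsingFlow (n : ℕ) (κ K : ℝ) (I : Finset ℕ) (a : ℕ → ℝ) (b : ℝ)
    (l y w : ℝ → ℝ) : Prop where
  κ_pos : 0 < κ
  K_nonneg : 0 ≤ K
  a_pos : ∀ i ∈ I, 0 < a i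
  y_pos : ∀ᶠ t in 𝓝[<] b, 0 < y t
  w_pos : ∀ᶠ t in 𝓝[<] b, 0 < w t
  y_deriv : ∀ᶠ t in 𝓝[<] b, HasDerivAt y (l t * y t) t
  w_deriv : ∀ᶠ t in 𝓝[<] b, HasDerivAt w (1 / y t ^ 2) t
  l_deriv : ∀ᶠ t in 𝓝[<] b,
    HasDerivAt l (-(l t) ^ 2 + κ / (y t ^ n * ∏ i ∈ I, (1 + a i * w t)) - K) t
  y_tendsto : Tendsto y (𝓝[<] b) (𝓝 0)
  l_tendsto : Tendsto l (𝓝[<] b) atBot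

namespace CollapsingFlow

variable {n : ℕ} {κ K : ℝ} {I : Finset ℕ} {a : ℕ → ℝ} {b : ℝ} {l y w : ℝ → ℝ}

theorem slope_deriv (h : CollapsingFlow n κ K I a b l y w) : ∀ᶠ t in 𝓝[<] b,
    HasDerivAt (fun t => l t * y t)
      ((κ / (y t ^ n * ∏ i ∈ I, (1 + a i * w t)) - K) * y t) t := by
  filter_upwards [h.l_deriv, h.y_deriv] with t h1 h2
  refine (h1.mul h2).congr_deriv ?_
  ring

theorem prod_pos (h : CollapsingFlow n κ K I a b l y w) :
    ∀ᶠ t in 𝓝[<] b, 0 < ∏ i ∈ I, (1 + a i * w t) := by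
  filter_upwards [h.w_pos] with t ht
  exact Finset.prod_pos fun i hi => add_pos one_pos (mul_pos (h.a_pos i hi) ht)

/-- The slope `y' = l y` has a finite limit, since `y'' ≥ -K y`. -/
theorem exists_slope_tendsto (h : CollapsingFlow n κ K I a b l y w) :
    ∃ L ≤ 0, Tendsto (fun t => l t * y t) (𝓝[<] b) (𝓝 L) := by
  have hneg : ∀ᶠ t in 𝓝[<] b, l t * y t ≤ 0 := by
    filter_upwards [h.y_pos, h.l_tendsto.eventually_le_atBot 0] with t h1 h2
    exact mul_nonpos_of_nonpos_of_nonneg h2 h1.le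
  obtain ⟨L, hL⟩ := exists_tendsto_of_deriv_ge (g := fun t => -K * t) (g' := fun t => -K * 1)
    h.slope_deriv (Eventually.of_forall fun t => (hasDerivAt_id t).const_mul (-K)) (by
      filter_upwards [h.y_pos, h.prod_pos, h.y_tendsto.eventually_lt_const one_pos] with t h1 h2 h3
      have h4 : 0 ≤ κ / (y t ^ n * ∏ i ∈ I, (1 + a i * w t)) :=
        div_nonneg h.κ_pos.le (mul_nonneg (pow_nonneg h1.le n) h2.le)
      nlinarith [mul_nonneg h4 h1.le, mul_le_mul_of_nonneg_left h3.le h.K_nonneg])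
    (tendsto_nhdsWithin_of_tendsto_nhds ((continuous_const.mul continuous_id).tendsto b)) hneg
  exact ⟨L, le_of_tendsto hL hneg, hL⟩

theorem inv_y_tendsto (h : CollapsingFlow n κ K I a b l y w) :
    Tendsto (fun t => (y t)⁻¹) (𝓝[<] b) atTop :=
  tendsto_inv_nhdsGT_zero.comp (tendsto_nhdsWithin_iff.2 ⟨h.y_tendsto, h.y_pos⟩)

theorem inv_y_deriv (h : CollapsingFlow n κ K I a b l y w) : ∀ᶠ t in 𝓝[<] b,
    HasDerivAt (fun t => (y t)⁻¹) (-(l t * y t) * (1 / y t ^ 2)) t := by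
  filter_upwards [h.y_deriv, h.y_pos] with t h1 h2
  refine (h1.inv h2.ne').congr_deriv ?_
  ring

theorem w_tendsto (h : CollapsingFlow n κ K I a b l y w) : Tendsto w (𝓝[<] b) atTop := by
  obtain ⟨L, hL0, hL⟩ := h.exists_slope_tendsto
  refine tendsto_atTop_of_deriv_ge (c := 1 / (1 - L)) (by apply one_div_pos.2; linarith)
    h.w_deriv h.inv_y_deriv ?_ h.inv_y_tendsto
  filter_upwards [hL.eventually_const_lt (sub_one_lt L)] with t ht
  have h1 : 0 ≤ 1 / y t ^ 2 := by positivity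
  have h2 : 0 < 1 - L := by linarith
  calc 1 / (1 - L) * (-(l t * y t) * (1 / y t ^ 2))
      ≤ 1 / (1 - L) * ((1 - L) * (1 / y t ^ 2)) := by
        refine mul_le_mul_of_nonneg_left (mul_le_mul_of_nonneg_right ?_ h1) (one_div_pos.2 h2).le
        linarith
    _ = 1 / y t ^ 2 := by field_simp

/-- The second solution `v = y w` of the linear equation `u'' = (l' + l²) u` satisfies
`1 / v → -L`. -/
theorem inv_v_tendsto (h : CollapsingFlow n κ K I a b l y w) {L : ℝ}
    (hL : Tendsto (fun t => l t * y t) (𝓝[<] b) (𝓝 L)) :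
    Tendsto (fun t => (y t * w t)⁻¹) (𝓝[<] b) (𝓝 (-L)) := by
  refine (tendsto_div_of_deriv_eq_mul h.inv_y_deriv h.w_deriv
    (Eventually.of_forall fun t => by positivity) hL.neg h.w_tendsto).congr fun t => ?_
  rw [mul_inv, div_eq_mul_inv]

theorem H_tendsto (h : CollapsingFlow n κ K I a b l y w) :
    Tendsto (fun t => y t ^ 2 * w t) (𝓝[<] b) (𝓝 0) := by
  have hg : ∀ᶠ t in 𝓝[<] b, HasDerivAt (fun t => (y t)⁻¹ ^ 2) (-2 * l t * (1 / y t ^ 2)) t := by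
    filter_upwards [h.inv_y_deriv, h.y_pos] with t h1 h2
    refine (h1.pow 2).congr_deriv ?_
    push_cast
    field_simp
  have hr : Tendsto (fun t => (-2 * l t)⁻¹) (𝓝[<] b) (𝓝 0) :=
    tendsto_inv_atTop_zero.comp (h.l_tendsto.const_mul_atBot_of_neg (by norm_num))
  have := tendsto_div_of_deriv_eq_mul (f := w) (r := fun t => (-2 * l t)⁻¹) (by
      filter_upwards [h.w_deriv, h.l_tendsto.eventually_lt_atBot 0] with t h1 h2
      refine h1.congr_deriv ?_
      have := h2.ne
      field_simp) hg (by
      filter_upwards [h.l_tendsto.eventually_lt_atBot 0] with t h2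
      exact mul_nonneg (by linarith) (by positivity)) hr
    ((tendsto_pow_atTop two_ne_zero).comp h.inv_y_tendsto)
  refine this.congr fun t => ?_
  rw [inv_pow, div_inv_eq_mul, mul_comm]

theorem prod_bounds (h : CollapsingFlow n κ K I a b l y w) : ∀ᶠ t in 𝓝[<] b,
    (∏ i ∈ I, a i) * w t ^ I.card ≤ ∏ i ∈ I, (1 + a i * w t) ∧
      ∏ i ∈ I, (1 + a i * w t) ≤ (∏ i ∈ I, (1 + a i)) * w t ^ I.card := by
  filter_upwards [h.w_tendsto.eventually_ge_atTop 1] with t ht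
  rw [← Finset.prod_const, ← Finset.prod_mul_distrib, ← Finset.prod_mul_distrib]
  refine ⟨Finset.prod_le_prod (fun i hi => ?_) (fun i hi => ?_),
    Finset.prod_le_prod (fun i hi => ?_) (fun i hi => ?_)⟩
  all_goals have := h.a_pos i hi
  · positivity
  · linarith
  · positivity
  · nlinarith

theorem prod_div_tendsto (h : CollapsingFlow n κ K I a b l y w) :
    Tendsto (fun t => (∏ i ∈ I, (1 + a i * w t)) / w t ^ I.card) (𝓝[<] b) (𝓝 (∏ i ∈ I, a i)) := by
  have : Tendsto (fun t => ∏ i ∈ I, ((w t)⁻¹ + a i)) (𝓝[<] b) (𝓝 (∏ i ∈ I, (0 + a i))) :=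
    tendsto_finsetProd _ fun i _ => ((tendsto_inv_atTop_zero.comp h.w_tendsto).add_const _)
  simp only [zero_add] at this
  refine this.congr' ?_
  filter_upwards [h.w_pos] with t ht
  rw [← Finset.prod_const, ← Finset.prod_div_distrib]
  refine Finset.prod_congr rfl fun i _ => ?_
  field_simp

theorem prod_a_pos (h : CollapsingFlow n κ K I a b l y w) : 0 < ∏ i ∈ I, a i :=
  Finset.prod_pos h.a_pos

/-- If a single component is smallest, it blows up like `y → 0` with nonzero slope: zero slope would
give `y'' ≤ C / (y w)`, hence `-y' ≤ C / √w` by the arithmetic-geometric mean inequality, and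
`y² w` would stay away from `0`. -/
theorem slope_neg (h : CollapsingFlow n κ K I a b l y w) (hn : 2 ≤ n) (hcard : I.card + 1 = n)
    {L : ℝ} (hL : Tendsto (fun t => l t * y t) (𝓝[<] b) (𝓝 L)) : L ≠ 0 := by
  rintro rfl
  have hv : Tendsto (fun t => (y t * w t)⁻¹) (𝓝[<] b) (𝓝 0) := by simpa using h.inv_v_tendsto hL
  set A := ∏ i ∈ I, a i
  have hA : 0 < A := h.prod_a_pos
  set C := κ / A
  have hC : 0 < C := div_pos h.κ_pos hA
  have hacc : ∀ᶠ t in 𝓝[<] b,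
      (κ / (y t ^ n * ∏ i ∈ I, (1 + a i * w t)) - K) * y t ≤ C * (y t * w t)⁻¹ := by
    filter_upwards [h.prod_bounds, h.prod_pos, h.y_pos, h.w_pos, hv.eventually_lt_const one_pos]
      with t h1 h2 h3 h4 h5
    obtain ⟨m, hm⟩ : ∃ m, I.card = m + 1 := ⟨I.card - 1, by omega⟩
    have hvpos : 0 < y t * w t := mul_pos h3 h4
    have hK : 0 ≤ K * y t := mul_nonneg h.K_nonneg h3.le
    have h6 : κ / (y t ^ n * ∏ i ∈ I, (1 + a i * w t)) ≤ κ / (y t ^ n * (A * w t ^ I.card)) :=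
      div_le_div_of_nonneg_left h.κ_pos.le (by positivity)
        (mul_le_mul_of_nonneg_left h1.1 (by positivity))
    have h7 : κ / (y t ^ n * (A * w t ^ I.card)) * y t = C * (y t * w t)⁻¹ ^ (m + 1) := by
      rw [← hcard, hm]
      simp only [C, mul_pow, inv_pow]
      field_simp
      ring
    have h8 : (y t * w t)⁻¹ ^ (m + 1) ≤ (y t * w t)⁻¹ ^ 1 :=
      pow_le_pow_of_le_one (inv_pos.2 hvpos).le h5.le (by omega)
    rw [pow_one] at h8
    have h9 := mul_le_mul_of_nonneg_right h6 h3.le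
    have h10 := mul_le_mul_of_nonneg_left h8 hC.le
    linarith
  -- pointwise bound of the slope
  have hslope : ∃ M > 0, ∀ᶠ t in 𝓝[<] b, -(l t * y t) ≤ M / √(w t) := by
    obtain ⟨u, hul, hus, huo, huc, hue⟩ := IsLeftApproach.exists_tail _
      (hacc.and (h.slope_deriv.and (h.w_deriv.and (h.w_pos.and (h.y_pos.and
        (eventually_mem_set.2 (Ioo_mem_nhdsLT (sub_one_lt b))))))))
    refine ⟨C, hC, ?_⟩
    filter_upwards [hul] with t ht
    obtain ⟨-, -, -, hwt, -, htb⟩ := hus ht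
    set d := (√(w t))⁻¹
    have hd : 0 < d := inv_pos.2 (Real.sqrt_pos.2 hwt)
    set F : ℝ → ℝ := fun s => C / 2 * (d * s - d⁻¹ * (w s)⁻¹) - l s * y s
    have hF : ∀ s ∈ u, HasDerivAt F (C / 2 * (d * 1 - d⁻¹ * (-(1 / y s ^ 2) / w s ^ 2))
        - (κ / (y s ^ n * ∏ i ∈ I, (1 + a i * w s)) - K) * y s) s := by
      intro s hs
      obtain ⟨-, h2, h3, h4, -⟩ := hus hs
      exact ((((hasDerivAt_id s).const_mul d).sub ((h3.inv h4.ne').const_mul d⁻¹)).const_mul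
        (C / 2)).sub h2
    have hmono := monotoneOn_of_hasDerivAt huo huc hF (by
      intro s hs
      obtain ⟨h1, -, -, h4, h5, -⟩ := hus hs
      have h6 : (y s * w s)⁻¹ ≤ (d + d⁻¹ * (y s * w s)⁻¹ ^ 2) / 2 := by
        have h7 : 0 ≤ d⁻¹ * (d - (y s * w s)⁻¹) ^ 2 := by positivity
        have h8 : d⁻¹ * (d - (y s * w s)⁻¹) ^ 2 =
            d - 2 * (y s * w s)⁻¹ + d⁻¹ * (y s * w s)⁻¹ ^ 2 := by
          field_simp
          ring
        linarith
      have h9 := mul_le_mul_of_nonneg_left h6 hC.le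
      have h10 : -(1 / y s ^ 2) / w s ^ 2 = -(y s * w s)⁻¹ ^ 2 := by
        field_simp
      rw [h10]
      linarith)
    have hlim : Tendsto F (𝓝[<] b) (𝓝 (C / 2 * (d * b - d⁻¹ * 0) - 0)) := by
      refine Tendsto.sub (Tendsto.const_mul _ (Tendsto.sub ?_ ?_)) hL
      · exact tendsto_nhdsWithin_of_tendsto_nhds ((continuous_const.mul continuous_id).tendsto b)
      · exact (tendsto_inv_atTop_zero.comp h.w_tendsto).const_mul _
    have hle : F t ≤ C / 2 * (d * b - d⁻¹ * 0) - 0 := by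
      refine ge_of_tendsto hlim ?_
      filter_upwards [hul, hue t ht] with s hs hts using hmono ht hs hts
    have hdw : d⁻¹ * (w t)⁻¹ = d := by
      have hs : √(w t) * √(w t) = w t := Real.mul_self_sqrt hwt.le
      have hs0 : √(w t) ≠ 0 := (Real.sqrt_pos.2 hwt).ne'
      simp only [d, inv_inv]
      nth_rewrite 2 [← hs]
      field_simp
    simp only [F, hdw] at hle
    have hbt : d * (b - t) ≤ d * 1 := mul_le_mul_of_nonneg_left (by linarith [htb.1]) hd.le
    rw [div_eq_mul_inv]
    change -(l t * y t) ≤ C * d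
    nlinarith
  obtain ⟨M, hM, hMt⟩ := hslope
  obtain ⟨c, hc⟩ := exists_le_add_of_deriv_le (g := fun t => 2 * M * √(w t))
    (g' := fun t => 2 * M * (1 / y t ^ 2 / (2 * √(w t)))) h.inv_y_deriv (by
      filter_upwards [h.w_deriv, h.w_pos] with t h1 h2
      exact (h1.sqrt h2.ne').const_mul (2 * M)) (by
      filter_upwards [hMt] with t h1
      calc -(l t * y t) * (1 / y t ^ 2) ≤ M / √(w t) * (1 / y t ^ 2) :=
            mul_le_mul_of_nonneg_right h1 (by positivity)
        _ = _ := by ring)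
  -- hence `1 / y ≤ (2 M + |c|) √w`, so `y √w` cannot tend to zero
  have hfin : ∀ᶠ t in 𝓝[<] b, (1 / (2 * M + |c|)) ^ 2 ≤ y t ^ 2 * w t := by
    filter_upwards [hc, h.y_pos, h.w_tendsto.eventually_ge_atTop 1] with t h1 h2 h3
    have h4 : 1 ≤ √(w t) := Real.one_le_sqrt.2 h3
    have h5 : (y t)⁻¹ ≤ (2 * M + |c|) * √(w t) := by
      have := le_abs_self c
      nlinarith [abs_nonneg c]
    have h6 : 0 < 2 * M + |c| := by positivity
    have h7 : 1 / (2 * M + |c|) ≤ y t * √(w t) := by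
      rw [div_le_iff₀ h6]
      have := mul_le_mul_of_nonneg_left h5 h2.le
      rw [mul_inv_cancel₀ h2.ne'] at this
      linarith
    calc (1 / (2 * M + |c|)) ^ 2 ≤ (y t * √(w t)) ^ 2 := by gcongr
      _ = _ := by rw [mul_pow, Real.sq_sqrt (by linarith)]
  have := ge_of_tendsto h.H_tendsto hfin
  have h6 : 0 < 2 * M + |c| := by positivity
  have : 0 < (1 / (2 * M + |c|)) ^ 2 := by positivity
  linarith

/-- If at least two components are smallest, the slope tends to zero: otherwise `y''` would exceed a
multiple of `-y' / y`, which is not integrable. -/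
theorem slope_eq_zero (h : CollapsingFlow n κ K I a b l y w) (hcard : I.card + 2 ≤ n)
    {L : ℝ} (hL : Tendsto (fun t => l t * y t) (𝓝[<] b) (𝓝 L)) : L = 0 := by
  by_contra hne
  have hL0 : L < 0 := by
    obtain ⟨L', hL', hL''⟩ := h.exists_slope_tendsto
    exact lt_of_le_of_ne (tendsto_nhds_unique hL hL'' ▸ hL') hne
  set A := ∏ i ∈ I, (1 + a i)
  have hA : 0 < A := Finset.prod_pos fun i hi => add_pos one_pos (h.a_pos i hi)
  set V := (-L / 2)⁻¹
  have hV : 0 < V := inv_pos.2 (by linarith)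
  set c := κ / (A * V ^ I.card) / 2 / (1 - L)
  have hc : 0 < c := by
    have := h.κ_pos
    have : 0 < 1 - L := by linarith
    positivity
  have hacc : ∀ᶠ t in 𝓝[<] b, c * -(l t * y t / y t) ≤
      (κ / (y t ^ n * ∏ i ∈ I, (1 + a i * w t)) - K) * y t := by
    have hky : ∀ᶠ t in 𝓝[<] b, K * y t ^ 2 < κ / (A * V ^ I.card) / 2 := by
      have : Tendsto (fun t => K * y t ^ 2) (𝓝[<] b) (𝓝 0) := by
        simpa using (h.y_tendsto.pow 2).const_mul K
      refine this.eventually_lt_const ?_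
      have := h.κ_pos
      positivity
    filter_upwards [h.prod_bounds, h.prod_pos, h.y_pos, h.w_pos, hky,
      (h.inv_v_tendsto hL).eventually_const_lt (show -L / 2 < -L by linarith),
      hL.eventually_const_lt (sub_one_lt L), h.y_tendsto.eventually_lt_const one_pos]
      with t h1 h2 h3 h4 h5 h6 h7 h8
    have hκ := h.κ_pos
    have hvV : y t * w t ≤ V := by
      have := inv_anti₀ (by linarith) h6.le
      rwa [inv_inv] at this
    have h9 : y t ^ n * ∏ i ∈ I, (1 + a i * w t) ≤ y t ^ 2 * (A * V ^ I.card) := by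
      calc y t ^ n * ∏ i ∈ I, (1 + a i * w t) ≤ y t ^ (I.card + 2) * (A * w t ^ I.card) :=
            mul_le_mul (pow_le_pow_of_le_one h3.le h8.le hcard) h1.2 h2.le (by positivity)
        _ = y t ^ 2 * (A * (y t * w t) ^ I.card) := by ring
        _ ≤ _ := by gcongr
    have h10 : κ / (A * V ^ I.card) / y t ^ 2 ≤ κ / (y t ^ n * ∏ i ∈ I, (1 + a i * w t)) := by
      rw [div_div]
      refine div_le_div_of_nonneg_left hκ.le (by positivity) ?_
      linarith
    have h11 : (κ / (A * V ^ I.card) / y t ^ 2 - K) * y t =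
        (κ / (A * V ^ I.card) - K * y t ^ 2) / y t := by field_simp
    have h12 := mul_le_mul_of_nonneg_right (sub_le_sub_right h10 K) h3.le
    refine le_trans ?_ h12
    rw [h11]
    have h13 : c * -(l t * y t / y t) = c * -(l t * y t) / y t := by ring
    rw [h13]
    refine div_le_div_of_nonneg_right ?_ h3.le
    have h14 : c * -(l t * y t) ≤ c * (1 - L) := mul_le_mul_of_nonneg_left (by linarith) hc.le
    have h15 : c * (1 - L) = κ / (A * V ^ I.card) / 2 := by
      have : 1 - L ≠ 0 := by linarith
      simp only [c]
      field_simp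
    linarith
  have htop := tendsto_atTop_of_deriv_ge hc h.slope_deriv (g := fun t => -Real.log (y t))
    (g' := fun t => -(l t * y t / y t)) (by
      filter_upwards [h.y_deriv, h.y_pos] with t h1 h2 using (h1.log h2.ne').neg) hacc
    (tendsto_neg_atBot_atTop.comp (Real.tendsto_log_nhdsGT_zero.comp
      (tendsto_nhdsWithin_iff.2 ⟨h.y_tendsto, h.y_pos⟩)))
  exact not_tendsto_nhds_of_tendsto_atTop htop _ hL

/-! ### From the collapsing flow to the phase plane -/

theorem H_pos (h : CollapsingFlow n κ K I a b l y w) : ∀ᶠ t in 𝓝[<] b, 0 < y t ^ 2 * w t := by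
  filter_upwards [h.y_pos, h.w_pos] with t h1 h2
  positivity

theorem H_deriv (h : CollapsingFlow n κ K I a b l y w) : ∀ᶠ t in 𝓝[<] b,
    HasDerivAt (fun t => y t ^ 2 * w t) (1 - 2 * (-l t * (y t ^ 2 * w t))) t := by
  filter_upwards [h.y_pos, h.y_deriv, h.w_deriv] with t h1 h2 h3
  refine ((h2.pow 2).mul h3).congr_deriv ?_
  simp only [Pi.pow_apply]
  field_simp
  ring

theorem prod_deriv (h : CollapsingFlow n κ K I a b l y w) : ∀ᶠ t in 𝓝[<] b,
    HasDerivAt (fun t => ∏ i ∈ I, (1 + a i * w t))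
      ((∏ i ∈ I, (1 + a i * w t)) * ∑ i ∈ I, a i / (y t ^ 2 * (1 + a i * w t))) t := by
  filter_upwards [h.y_pos, h.w_pos, h.w_deriv] with t h1 h2 h3
  have key : ∀ S ⊆ I, HasDerivAt (fun t => ∏ i ∈ S, (1 + a i * w t))
      ((∏ i ∈ S, (1 + a i * w t)) * ∑ i ∈ S, a i / (y t ^ 2 * (1 + a i * w t))) t := by
    intro S
    induction S using Finset.induction_on with
    | empty =>
      intro _
      simpa using hasDerivAt_const t (1 : ℝ)
    | insert i S hi ih =>
      intro hS
      rw [Finset.insert_subset_iff] at hS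
      have hai := h.a_pos i hS.1
      simp only [Finset.prod_insert hi, Finset.sum_insert hi]
      refine (((h3.const_mul (a i)).const_add 1).mul (ih hS.2)).congr_deriv ?_
      have : 1 + a i * w t ≠ 0 := by positivity
      generalize ∏ i ∈ S, (1 + a i * w t) = P
      generalize ∑ i ∈ S, a i / (y t ^ 2 * (1 + a i * w t)) = R
      field_simp
  exact key I subset_rfl

/-- Passage to the time `s = ln w`; `T` is the inverse time change. -/
theorem exists_phaseFlow (h : CollapsingFlow n κ K I a b l y w) :
    ∃ T : ℝ → ℝ, Tendsto T atTop (𝓝[<] b) ∧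
      (∀ᶠ s in atTop, HasDerivAt T (y (T s) ^ 2 * w (T s)) s) ∧
      (∀ᶠ s in atTop, w (T s) = Real.exp s) ∧
      (∀ (f : ℝ → ℝ) (F : Filter ℝ), Tendsto (fun s => f (T s)) atTop F → Tendsto f (𝓝[<] b) F) ∧
      PhaseFlow K (fun s => -l (T s) * (y (T s) ^ 2 * w (T s)))
        (fun s => κ * (y (T s) ^ 2 * w (T s)) ^ 2 /
          (y (T s) ^ n * ∏ i ∈ I, (1 + a i * w (T s))))
        (fun s => y (T s) ^ 2 * w (T s)) ∧
      ∀ᶠ s in atTop, HasDerivAt (fun s => κ * (y (T s) ^ 2 * w (T s)) ^ 2 /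
          (y (T s) ^ n * ∏ i ∈ I, (1 + a i * w (T s))))
        (κ * (y (T s) ^ 2 * w (T s)) ^ 2 / (y (T s) ^ n * ∏ i ∈ I, (1 + a i * w (T s))) *
          (((n : ℝ) - 4) * (-l (T s) * (y (T s) ^ 2 * w (T s))) + 2 - I.card
            + ∑ i ∈ I, 1 / (1 + a i * w (T s)))) s := by
  obtain ⟨T, hT, hTd, hσT, hTσ⟩ := exists_inverse_clock (σ := fun t => Real.log (w t))
    (σ' := fun t => 1 / y t ^ 2 / w t) (b := b) (by
      filter_upwards [h.w_deriv, h.w_pos] with t h1 h2 using h1.log h2.ne') (by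
      filter_upwards [h.y_pos, h.w_pos] with t h1 h2
      positivity) (Real.tendsto_log_atTop.comp h.w_tendsto)
  have hTd' : ∀ᶠ s in atTop, HasDerivAt T (y (T s) ^ 2 * w (T s)) s := by
    filter_upwards [hTd] with s h1
    refine h1.congr_deriv ?_
    rw [div_div, inv_div, div_one]
  have hwT : ∀ᶠ s in atTop, w (T s) = Real.exp s := by
    filter_upwards [hσT, hT.eventually h.w_pos] with s h1 h2
    rw [← h1, Real.exp_log h2, h1]
  refine ⟨T, hT, hTd', hwT, ?_, ?_, ?_⟩
  · intro f F hf
    refine (hf.comp (Real.tendsto_log_atTop.comp h.w_tendsto)).congr' ?_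
    filter_upwards [hTσ] with t ht
    simp only [Function.comp_apply]
    rw [ht]
  · refine ⟨h.K_nonneg, ?_, ?_, ?_, ?_, hT.eventually h.H_pos, h.H_tendsto.comp hT⟩
    · filter_upwards [hTd', hT.eventually h.l_deriv, hT.eventually h.H_deriv,
        hT.eventually h.y_pos, hT.eventually h.w_pos, hT.eventually h.prod_pos]
        with s h1 h2 h3 h4 h5 h6
      refine (((h2.comp s h1).neg).mul (h3.comp s h1)).congr_deriv ?_
      simp only [Function.comp_apply, Pi.neg_apply]
      generalize (∏ i ∈ I, (1 + a i * w (T s))) = P at *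
      field_simp
      ring
    · filter_upwards [hTd', hT.eventually h.H_deriv] with s h1 h2
      refine (h2.comp s h1).congr_deriv ?_
      ring
    · filter_upwards [hT.eventually h.H_pos, hT.eventually (h.l_tendsto.eventually_lt_atBot 0)]
        with s h1 h2
      exact mul_pos (neg_pos.2 h2) h1
    · filter_upwards [hT.eventually h.H_pos, hT.eventually h.y_pos, hT.eventually h.prod_pos]
        with s h1 h2 h3
      have := h.κ_pos
      positivity
  · filter_upwards [hTd', hT.eventually h.prod_deriv, hT.eventually h.H_deriv,
        hT.eventually h.y_pos, hT.eventually h.w_pos, hT.eventually h.prod_pos,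
        hT.eventually h.y_deriv] with s h1 h2 h3 h4 h5 h6 h7
    have hsum : (y (T s) ^ 2 * w (T s)) * ∑ i ∈ I, a i / (y (T s) ^ 2 * (1 + a i * w (T s))) =
        I.card - ∑ i ∈ I, 1 / (1 + a i * w (T s)) := by
      rw [Finset.mul_sum, eq_sub_iff_add_eq, ← Finset.sum_add_distrib, Finset.cast_card]
      refine Finset.sum_congr rfl fun i hi => ?_
      have := h.a_pos i hi
      have : 1 + a i * w (T s) ≠ 0 := by positivity
      field_simp
      ring
    have hden : y (T s) ^ n * ∏ i ∈ I, (1 + a i * w (T s)) ≠ 0 := by positivity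
    have hyn : HasDerivAt (fun t => y t ^ n) ((n : ℝ) * l (T s) * y (T s) ^ n) (T s) := by
      refine (h7.pow n).congr_deriv ?_
      rcases n with _ | m
      · simp
      · simp only [Nat.add_sub_cancel]
        ring
    have hX := ((((h3.pow 2).const_mul κ).div (hyn.mul h2) hden)).comp s h1
    refine hX.congr_deriv ?_
    have hcard : (I.card : ℝ) - ∑ i ∈ I, 1 / (1 + a i * w (T s)) = (y (T s) ^ 2 * w (T s)) *
      ∑ i ∈ I, a i / (y (T s) ^ 2 * (1 + a i * w (T s))) := hsum.symm
    have hrw : ((n : ℝ) - 4) * (-l (T s) * (y (T s) ^ 2 * w (T s))) + 2 - I.card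
            + ∑ i ∈ I, 1 / (1 + a i * w (T s)) =
        ((n : ℝ) - 4) * (-l (T s) * (y (T s) ^ 2 * w (T s))) + 2 - (y (T s) ^ 2 * w (T s)) *
      ∑ i ∈ I, a i / (y (T s) ^ 2 * (1 + a i * w (T s))) := by
      rw [← hcard]; ring
    rw [hrw]
    generalize ∑ i ∈ I, a i / (y (T s) ^ 2 * (1 + a i * w (T s))) = S
    simp only [Pi.pow_apply, Pi.mul_apply]
    generalize (∏ i ∈ I, (1 + a i * w (T s))) = P at *
    field_simp
    push_cast
    ring

theorem tendsto_p_of_tendsto_X (h : CollapsingFlow n κ K I a b l y w) {x : ℝ}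
    (hX : Tendsto (fun t => κ * (y t ^ 2 * w t) ^ 2 / (y t ^ n * ∏ i ∈ I, (1 + a i * w t)))
      (𝓝[<] b) (𝓝 x)) :
    x ≤ 1 / 4 ∧ (x < 1 / 4 →
      Tendsto (fun t => -l t * (y t ^ 2 * w t)) (𝓝[<] b) (𝓝 (1 / 2 + √(1 / 4 - x)))) := by
  obtain ⟨T, hT, -, -, htr, hflow, -⟩ := h.exists_phaseFlow
  exact ⟨hflow.le_quarter_of_tendsto (hX.comp hT),
    fun hx => htr _ _ (hflow.tendsto_of_tendsto hx (hX.comp hT))⟩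

theorem not_tendsto_X_atTop (h : CollapsingFlow n κ K I a b l y w) :
    ¬ Tendsto (fun t => κ * (y t ^ 2 * w t) ^ 2 / (y t ^ n * ∏ i ∈ I, (1 + a i * w t)))
      (𝓝[<] b) atTop := by
  obtain ⟨T, hT, -, -, -, hflow, -⟩ := h.exists_phaseFlow
  exact fun hX => hflow.not_tendsto_atTop (hX.comp hT)

/-- With at least two smallest components the second solution `v = y w` tends to infinity. -/
theorem v_tendsto (h : CollapsingFlow n κ K I a b l y w) (hcard : I.card + 2 ≤ n) :
    Tendsto (fun t => (y t * w t)⁻¹) (𝓝[<] b) (𝓝 0) := by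
  obtain ⟨L, -, hL⟩ := h.exists_slope_tendsto
  have := h.slope_eq_zero hcard hL
  subst this
  simpa using h.inv_v_tendsto hL

/-- Collapse of two or more components forces `n ≥ 5`, or `n = 4` with exactly two of them:
otherwise `X` is at least a multiple of `v = y w` and tends to infinity. -/
theorem five_le_or (h : CollapsingFlow n κ K I a b l y w) (hn : 2 ≤ n) (hcard : I.card + 2 ≤ n) :
    5 ≤ n ∨ (n = 4 ∧ I.card = 2) := by
  by_contra hcon
  have hvt : Tendsto (fun t => y t * w t) (𝓝[<] b) atTop := by
    have h1 := tendsto_inv_nhdsGT_zero.comp (tendsto_nhdsWithin_iff.2 ⟨h.v_tendsto hcard, by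
      filter_upwards [h.y_pos, h.w_pos] with t h1 h2
      exact inv_pos.2 (mul_pos h1 h2)⟩)
    refine h1.congr fun t => ?_
    simp
  set A := ∏ i ∈ I, (1 + a i)
  have hA : 0 < A := Finset.prod_pos fun i hi => add_pos one_pos (h.a_pos i hi)
  have hκA : 0 < κ / A := div_pos h.κ_pos hA
  refine h.not_tendsto_X_atTop (tendsto_atTop_mono' _ ?_ (hvt.const_mul_atTop hκA))
  filter_upwards [h.prod_bounds, h.prod_pos, h.y_pos, h.w_tendsto.eventually_ge_atTop 1,
    h.y_tendsto.eventually_lt_const one_pos, hvt.eventually_ge_atTop 1] with t h1 h2 h3 h4 h5 h10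
  have hκ := h.κ_pos
  have hw : 0 < w t := by linarith
  have hkey : y t * w t * (y t ^ n * w t ^ I.card) ≤ (y t ^ 2 * w t) ^ 2 := by
    have h6 : y t ^ 4 * w t ≤ y t ^ 4 * w t ^ 2 := by
      refine mul_le_mul_of_nonneg_left ?_ (by positivity)
      nlinarith
    have h7 : y t ^ 5 * w t ^ 2 ≤ y t ^ 4 * w t ^ 2 := by
      refine mul_le_mul_of_nonneg_right ?_ (by positivity)
      exact pow_le_pow_of_le_one h3.le h5.le (by norm_num)
    have h8 : y t ^ 5 * w t ≤ y t ^ 4 * w t := by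
      refine mul_le_mul_of_nonneg_right ?_ (by positivity)
      exact pow_le_pow_of_le_one h3.le h5.le (by norm_num)
    have h9 : y t ^ 2 * (y t * w t) ≤ y t ^ 2 * (y t * w t) ^ 2 := by
      refine mul_le_mul_of_nonneg_left ?_ (by positivity)
      nlinarith
    generalize I.card = m at hcard hcon
    have hn5 : n < 5 := by omega
    have hm : m ≤ 1 := by omega
    interval_cases n <;> interval_cases m <;> first | omega | linarith
  calc κ / A * (y t * w t) = κ * (y t * w t * (y t ^ n * w t ^ I.card)) /
        (y t ^ n * (A * w t ^ I.card)) := by field_simp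
    _ ≤ κ * (y t ^ 2 * w t) ^ 2 / (y t ^ n * (A * w t ^ I.card)) := by gcongr
    _ ≤ _ := div_le_div_of_nonneg_left (by positivity) (by positivity)
        (mul_le_mul_of_nonneg_left h1.2 (by positivity))

/-! ### Blow-up rates -/

theorem tendsto_sub_nhdsLT (b : ℝ) : Tendsto (fun t => b - t) (𝓝[<] b) (𝓝 0) := by
  have : Tendsto (fun t => b - t) (𝓝 b) (𝓝 (b - b)) :=
    (continuous_const.sub continuous_id).tendsto b
  rw [sub_self] at this
  exact tendsto_nhdsWithin_of_tendsto_nhds this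

/-- If `p = -l y² w` has a limit `q`, then `y² w ~ (2 q - 1) (b - t)`. -/
theorem H_div_tendsto (h : CollapsingFlow n κ K I a b l y w) {q : ℝ}
    (hp : Tendsto (fun t => -l t * (y t ^ 2 * w t)) (𝓝[<] b) (𝓝 q)) :
    Tendsto (fun t => y t ^ 2 * w t / (b - t)) (𝓝[<] b) (𝓝 (2 * q - 1)) := by
  refine HasDerivAt.lhopital_zero_nhdsLT h.H_deriv
    (Eventually.of_forall fun t => (hasDerivAt_id t).const_sub b)
    (Eventually.of_forall fun t => by norm_num) h.H_tendsto (tendsto_sub_nhdsLT b) ?_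
  have : Tendsto (fun t => (1 - 2 * (-l t * (y t ^ 2 * w t))) / -1) (𝓝[<] b)
      (𝓝 ((1 - 2 * q) / -1)) := ((hp.const_mul 2).const_sub 1).div_const _
  convert this using 2
  ring

theorem l_rate (h : CollapsingFlow n κ K I a b l y w) {q : ℝ} (hq : 1 / 2 < q)
    (hp : Tendsto (fun t => -l t * (y t ^ 2 * w t)) (𝓝[<] b) (𝓝 q)) :
    Tendsto (fun t => (b - t) * l t) (𝓝[<] b) (𝓝 (-(q / (2 * q - 1)))) := by
  have := (hp.div (h.H_div_tendsto hp) (by linarith)).neg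
  refine this.congr' ?_
  filter_upwards [h.H_pos] with t h1
  simp only [Pi.div_apply]
  rw [div_div_eq_mul_div, neg_mul, neg_mul, neg_div, neg_neg, div_eq_iff h1.ne']
  ring

theorem ratio_tendsto (h : CollapsingFlow n κ K I a b l y w) {α : ℝ} (hα : 0 < α) :
    Tendsto (fun t => α * w t / (1 + α * w t)) (𝓝[<] b) (𝓝 1) := by
  have h1 : Tendsto (fun t => 1 - (1 + α * w t)⁻¹) (𝓝[<] b) (𝓝 (1 - 0)) :=
    (tendsto_inv_atTop_zero.comp (tendsto_atTop_add_const_left _ _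
      (h.w_tendsto.const_mul_atTop hα))).const_sub 1
  rw [sub_zero] at h1
  refine h1.congr' ?_
  filter_upwards [h.w_pos] with t ht
  have : 1 + α * w t ≠ 0 := by positivity
  field_simp
  ring

theorem component_rate (h : CollapsingFlow n κ K I a b l y w) {q α : ℝ} (hq : 1 / 2 < q)
    (hα : 0 < α) (hp : Tendsto (fun t => -l t * (y t ^ 2 * w t)) (𝓝[<] b) (𝓝 q)) :
    Tendsto (fun t => (b - t) * (l t + α / (y t ^ 2 * (1 + α * w t)))) (𝓝[<] b)
      (𝓝 ((1 - q) / (2 * q - 1))) := by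
  have h1 := ((h.H_div_tendsto hp).inv₀ (by linarith)).mul (h.ratio_tendsto hα)
  have h2 := (h.l_rate hq hp).add h1
  have h3 : -(q / (2 * q - 1)) + (2 * q - 1)⁻¹ * 1 = (1 - q) / (2 * q - 1) := by
    have : 2 * q - 1 ≠ 0 := by linarith
    field_simp
    ring
  rw [h3] at h2
  refine h2.congr' ?_
  filter_upwards [h.y_pos, h.w_pos] with t h4 h5
  have : 1 + α * w t ≠ 0 := by positivity
  rw [inv_div]
  field_simp

/-- The density term `κ / (yⁿ ∏ (1 + aᵢ w))` equals `X / H²`, which gives its rate. -/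
theorem density_rate (h : CollapsingFlow n κ K I a b l y w) {q x : ℝ} (hq : 1 / 2 < q)
    (hp : Tendsto (fun t => -l t * (y t ^ 2 * w t)) (𝓝[<] b) (𝓝 q))
    (hX : Tendsto (fun t => κ * (y t ^ 2 * w t) ^ 2 / (y t ^ n * ∏ i ∈ I, (1 + a i * w t)))
      (𝓝[<] b) (𝓝 x)) :
    Tendsto (fun t => (b - t) ^ 2 * (κ / (y t ^ n * ∏ i ∈ I, (1 + a i * w t)))) (𝓝[<] b)
      (𝓝 (x / (2 * q - 1) ^ 2)) := by
  refine (hX.div ((h.H_div_tendsto hp).pow 2) (pow_ne_zero _ (by linarith))).congr' ?_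
  filter_upwards [h.H_pos, self_mem_nhdsWithin] with t h1 h2
  have h3 : b - t ≠ 0 := sub_ne_zero.2 (ne_of_gt h2)
  simp only [Pi.div_apply]
  generalize (y t ^ n * ∏ i ∈ I, (1 + a i * w t)) = Q
  generalize y t ^ 2 * w t = H at *
  field_simp

/-! ### A single smallest component -/

theorem p_tendsto_one (h : CollapsingFlow n κ K I a b l y w) (hn : 2 ≤ n)
    (hcard : I.card + 1 = n) :
    Tendsto (fun t => -l t * (y t ^ 2 * w t)) (𝓝[<] b) (𝓝 1) := by
  obtain ⟨L, -, hL⟩ := h.exists_slope_tendsto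
  have hL0 := h.slope_neg hn hcard hL
  have h1 := hL.neg.mul ((h.inv_v_tendsto hL).inv₀ (neg_ne_zero.2 hL0))
  rw [mul_inv_cancel₀ (neg_ne_zero.2 hL0)] at h1
  refine h1.congr fun t => ?_
  rw [inv_inv]
  ring

theorem exists_density_rate_simple (h : CollapsingFlow n κ K I a b l y w) (hn : 2 ≤ n)
    (hcard : I.card + 1 = n) : ∃ c,
    Tendsto (fun t => (b - t) * (κ / (y t ^ n * ∏ i ∈ I, (1 + a i * w t)))) (𝓝[<] b) (𝓝 c) := by
  obtain ⟨L, -, hL⟩ := h.exists_slope_tendsto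
  have hL0 := h.slope_neg hn hcard hL
  have hy : Tendsto (fun t => y t / (b - t)) (𝓝[<] b) (𝓝 (L / -1)) :=
    HasDerivAt.lhopital_zero_nhdsLT h.y_deriv
      (Eventually.of_forall fun t => (hasDerivAt_id t).const_sub b)
      (Eventually.of_forall fun t => by norm_num) h.y_tendsto (tendsto_sub_nhdsLT b)
      (hL.div_const _)
  have h1 := (((h.inv_v_tendsto hL).pow I.card).const_mul κ).div
    (h.prod_div_tendsto) h.prod_a_pos.ne'
  have h2 := (hy.inv₀ (div_ne_zero hL0 (by norm_num))).mul h1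
  refine ⟨_, h2.congr' ?_⟩
  filter_upwards [h.y_pos, h.w_pos, h.prod_pos, self_mem_nhdsWithin] with t h3 h4 h5 h6
  have h7 : b - t ≠ 0 := sub_ne_zero.2 (ne_of_gt h6)
  rw [← hcard]
  simp only [Pi.div_apply]
  generalize (∏ i ∈ I, (1 + a i * w t)) = P at *
  rw [inv_div, mul_inv, mul_pow, inv_pow, inv_pow]
  field_simp
  ring

theorem component_deriv (h : CollapsingFlow n κ K I a b l y w) {α : ℝ} (hα : 0 < α) :
    ∀ᶠ t in 𝓝[<] b, HasDerivAt (fun t => l t + α / (y t ^ 2 * (1 + α * w t)))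
      (-(l t + α / (y t ^ 2 * (1 + α * w t))) ^ 2
        + κ / (y t ^ n * ∏ i ∈ I, (1 + a i * w t)) - K) t := by
  filter_upwards [h.y_pos, h.w_pos, h.l_deriv, h.y_deriv, h.w_deriv] with t h1 h2 h3 h4 h5
  have hu : 1 + α * w t ≠ 0 := by positivity
  have hd := ((h4.pow 2).mul ((h5.const_mul α).const_add 1))
  refine (h3.add ((hasDerivAt_const t α).div hd (by
    simp only [Pi.mul_apply, Pi.pow_apply]
    positivity))).congr_deriv ?_
  simp only [Pi.mul_apply, Pi.pow_apply]
  generalize κ / (y t ^ n * ∏ i ∈ I, (1 + a i * w t)) = Q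
  push_cast
  field_simp
  ring

/-- The other components are `O(|ln (b - t)|)`: from above because the density is `O(1 / (b - t))`,
from below because `u = y (1 + α w)` has a positive limit and `u'' ≥ -K u`. -/
theorem component_isBigO_log (h : CollapsingFlow n κ K I a b l y w) (hn : 2 ≤ n)
    (hcard : I.card + 1 = n) {α : ℝ} (hα : 0 < α) :
    (fun t => l t + α / (y t ^ 2 * (1 + α * w t))) =O[𝓝[<] b] fun t => |Real.log (b - t)| := by
  set μ : ℝ → ℝ := fun t => l t + α / (y t ^ 2 * (1 + α * w t))
  have hμ := h.component_deriv hα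
  obtain ⟨c, hc⟩ := h.exists_density_rate_simple hn hcard
  obtain ⟨L, -, hL⟩ := h.exists_slope_tendsto
  have hL0 := h.slope_neg hn hcard hL
  have hLneg : 0 < -L := by
    refine lt_of_le_of_ne ?_ (neg_ne_zero.2 hL0).symm
    refine ge_of_tendsto (h.inv_v_tendsto hL) ?_
    filter_upwards [h.y_pos, h.w_pos] with t h1 h2
    positivity
  -- upper bound
  obtain ⟨C₁, hC₁⟩ := exists_le_add_of_deriv_le (f := μ)
    (g := fun t => (|c| + 1) * -Real.log (b - t)) (g' := fun t => (|c| + 1) * -(-1 / (b - t))) hμ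
    (by
      filter_upwards [self_mem_nhdsWithin] with t ht
      exact ((((hasDerivAt_id t).const_sub b).log
        (sub_ne_zero.2 (ne_of_gt ht))).neg).const_mul _) (by
      filter_upwards [self_mem_nhdsWithin, hc.eventually_lt_const
        (show c < |c| + 1 by linarith [le_abs_self c])] with t ht h2
      have h3 : 0 < b - t := sub_pos.2 ht
      have h4 : κ / (y t ^ n * ∏ i ∈ I, (1 + a i * w t)) ≤ (|c| + 1) / (b - t) := by
        rw [le_div_iff₀ h3, mul_comm]
        exact h2.le
      have h5 : (|c| + 1) * -(-1 / (b - t)) = (|c| + 1) / (b - t) := by ring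
      have := h.K_nonneg
      rw [h5]
      linarith [sq_nonneg (l t + α / (y t ^ 2 * (1 + α * w t)))])
  -- lower bound
  set u : ℝ → ℝ := fun t => y t * (1 + α * w t)
  have hu : Tendsto u (𝓝[<] b) (𝓝 (α * (-L)⁻¹)) := by
    have h1 := h.y_tendsto.add (((h.inv_v_tendsto hL).inv₀ hLneg.ne').const_mul α)
    rw [zero_add] at h1
    refine h1.congr fun t => ?_
    simp only [u, inv_inv]
    ring
  have hu0 : 0 < α * (-L)⁻¹ := by positivity
  set m := α * (-L)⁻¹
  have hud : ∀ᶠ t in 𝓝[<] b, HasDerivAt u (μ t * u t) t := by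
    filter_upwards [h.y_pos, h.w_pos, h.y_deriv, h.w_deriv] with t h1 h2 h3 h4
    have : 1 + α * w t ≠ 0 := by positivity
    refine (h3.mul ((h4.const_mul α).const_add 1)).congr_deriv ?_
    simp only [μ, u]
    field_simp
  have hμu : ∀ᶠ t in 𝓝[<] b, HasDerivAt (fun t => μ t * u t)
      ((κ / (y t ^ n * ∏ i ∈ I, (1 + a i * w t)) - K) * u t) t := by
    filter_upwards [hμ, hud] with t h1 h2
    refine (h1.mul h2).congr_deriv ?_
    simp only [μ]
    ring
  obtain ⟨C₂, hC₂⟩ := exists_le_add_of_deriv_le (g := fun t => μ t * u t)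
    (f := fun t => -(K * (m + 1)) * t) (f' := fun t => -(K * (m + 1)) * 1)
    (Eventually.of_forall fun t => (hasDerivAt_id t).const_mul _) hμu (by
      filter_upwards [h.y_pos, h.prod_pos, hu.eventually_lt_const (lt_add_one m),
        hu.eventually_const_lt hu0] with t h1 h2 h3 h4
      have h5 : 0 ≤ κ / (y t ^ n * ∏ i ∈ I, (1 + a i * w t)) :=
        div_nonneg h.κ_pos.le (by positivity)
      have h6 := mul_le_mul_of_nonneg_left h3.le h.K_nonneg
      have h7 := mul_nonneg h5 h4.le
      linarith)
  set D := |K * (m + 1)| * (|b| + 1) + |C₂|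
  have hlow : ∀ᶠ t in 𝓝[<] b, -(2 * D / m) ≤ μ t := by
    filter_upwards [hC₂, hu.eventually_const_lt (half_lt_self hu0),
      Ioo_mem_nhdsLT (sub_one_lt b)] with t h1 h2 h3
    have htb : |t| ≤ |b| + 1 := by
      rw [abs_le]
      constructor
      · linarith [h3.1, neg_abs_le b]
      · linarith [h3.2, le_abs_self b]
    have h4 : -D ≤ μ t * u t := by
      have h5 : K * (m + 1) * t ≤ |K * (m + 1)| * (|b| + 1) :=
        (le_abs_self _).trans (by rw [abs_mul]; gcongr)
      have := le_abs_self C₂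
      simp only [D]
      linarith
    have hD : 0 ≤ D := by positivity
    by_contra hcon
    push Not at hcon
    have h6 : μ t * u t < -D := by
      have h7 : μ t < 0 := hcon.trans_le (neg_nonpos.2 (by positivity))
      have h8 : μ t * u t ≤ μ t * (m / 2) := mul_le_mul_of_nonpos_left h2.le h7.le
      have h9 : μ t * (m / 2) < -(2 * D / m) * (m / 2) :=
        mul_lt_mul_of_pos_right hcon (half_pos hu0)
      have h10 : -(2 * D / m) * (m / 2) = -D := by field_simp
      linarith
    linarith
  refine IsBigO.of_bound (|c| + 1 + |C₁| + 2 * D / m) ?_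
  have hlog : Tendsto (fun t => Real.log (b - t)) (𝓝[<] b) atBot :=
    Real.tendsto_log_nhdsGT_zero.comp (tendsto_nhdsWithin_iff.2 ⟨tendsto_sub_nhdsLT b, by
      filter_upwards [self_mem_nhdsWithin] with t ht using sub_pos.2 (show t < b from ht)⟩)
  filter_upwards [hC₁, hlow, hlog.eventually_le_atBot (-1)] with t h1 h2 h3
  rw [Real.norm_eq_abs, Real.norm_eq_abs, abs_abs,
    abs_of_nonpos (a := Real.log (b - t)) (by linarith)]
  have hD : 0 ≤ 2 * D / m := by positivity
  have h4 : 1 ≤ -Real.log (b - t) := by linarith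
  have h5 := le_abs_self C₁
  have h6 := abs_nonneg C₁
  have h7 := abs_nonneg c
  rw [abs_le]
  constructor
  · nlinarith
  · nlinarith

/-! ### Two smallest components -/

theorem X_tendsto_zero (h : CollapsingFlow n κ K I a b l y w) (hn : 5 ≤ n)
    (hcard : I.card + 2 = n) :
    Tendsto (fun t => κ * (y t ^ 2 * w t) ^ 2 / (y t ^ n * ∏ i ∈ I, (1 + a i * w t)))
      (𝓝[<] b) (𝓝 0) := by
  have h1 := (((h.v_tendsto hcard.le).pow (n - 4)).const_mul κ).div h.prod_div_tendsto
    h.prod_a_pos.ne'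
  rw [zero_pow (by omega), mul_zero, zero_div] at h1
  refine h1.congr' ?_
  filter_upwards [h.y_pos, h.w_pos, h.prod_pos] with t h2 h3 h4
  obtain ⟨m, rfl⟩ : ∃ m, n = m + 4 := ⟨n - 4, by omega⟩
  have hc : I.card = m + 2 := by omega
  simp only [Pi.div_apply, hc, Nat.add_sub_cancel]
  generalize (∏ i ∈ I, (1 + a i * w t)) = P at *
  rw [mul_inv, mul_pow, inv_pow, inv_pow]
  field_simp
  ring

theorem X_tendsto_four (h : CollapsingFlow 4 κ K I a b l y w) (hcard : I.card = 2) :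
    Tendsto (fun t => κ * (y t ^ 2 * w t) ^ 2 / (y t ^ 4 * ∏ i ∈ I, (1 + a i * w t)))
      (𝓝[<] b) (𝓝 (κ / ∏ i ∈ I, a i)) := by
  have h1 := (tendsto_const_nhds (x := κ)).div h.prod_div_tendsto h.prod_a_pos.ne'
  refine h1.congr' ?_
  filter_upwards [h.y_pos, h.w_pos, h.prod_pos] with t h2 h3 h4
  simp only [Pi.div_apply, hcard]
  generalize (∏ i ∈ I, (1 + a i * w t)) = P at *
  field_simp

/-- The critical case `κ / ∏ aᵢ = 1 / 4` in dimension four, with rates `(b - t)⁻²`. -/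
theorem critical_rates (h : CollapsingFlow 4 κ K I a b l y w) (hcard : I.card = 2)
    (hκ : κ / ∏ i ∈ I, a i = 1 / 4) : ∃ C > 0,
    Tendsto (fun t => (b - t) ^ 2 * l t) (𝓝[<] b) (𝓝 (-C)) ∧
    (∀ α > 0, Tendsto (fun t => (b - t) ^ 2 * (l t + α / (y t ^ 2 * (1 + α * w t)))) (𝓝[<] b)
      (𝓝 C)) ∧
    Tendsto (fun t => (b - t) ^ 4 * (κ / (y t ^ 4 * ∏ i ∈ I, (1 + a i * w t)))) (𝓝[<] b)
      (𝓝 (C ^ 2)) := by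
  have hX := h.X_tendsto_four hcard
  rw [hκ] at hX
  set A := ∏ i ∈ I, a i
  have hA : 0 < A := h.prod_a_pos
  have hκA : A = 4 * κ := by
    rw [div_eq_iff hA.ne'] at hκ
    linarith
  obtain ⟨B, hB⟩ : ∃ B, ∀ᶠ t in 𝓝[<] b,
      ∏ i ∈ I, (1 + a i * w t) ≤ A * w t ^ 2 + B * w t := by
    obtain ⟨i, j, hij, rfl⟩ := Finset.card_eq_two.1 hcard
    refine ⟨1 + a i + a j, ?_⟩
    filter_upwards [h.w_tendsto.eventually_ge_atTop 1] with t ht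
    simp only [A, Finset.prod_pair hij]
    nlinarith
  obtain ⟨T, hT, hTd, hwT, htr, hflow, -⟩ := h.exists_phaseFlow
  obtain ⟨ℓ, hℓ, hlim⟩ := hflow.exists_tendsto_div_sqrt (C := 1) (D := B / (4 * A)) (τ := T) hTd
    (tendsto_nhds_of_tendsto_nhdsWithin hT) (by
      filter_upwards [hT.eventually h.prod_bounds, hT.eventually h.prod_pos,
        hT.eventually h.y_pos, hT.eventually h.w_pos] with s h1 h2 h3 h4
      rw [hcard] at h1
      change A * _ ≤ _ ∧ _ at h1
      rw [div_le_iff₀ (by positivity)]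
      have h5 : 0 ≤ y (T s) ^ 4 := by positivity
      nlinarith [mul_le_mul_of_nonneg_left h1.1 h5]) (by
      filter_upwards [hT.eventually h.prod_bounds, hT.eventually h.prod_pos,
        hT.eventually h.y_pos, hT.eventually h.w_pos, hT.eventually hB, hwT]
        with s h1 h2 h3 h4 h5 h6
      rw [hcard] at h1
      change A * _ ≤ _ ∧ _ at h1
      rw [Real.exp_neg, ← h6]
      have hAw : 0 < A * w (T s) ^ 2 := by positivity
      have h7 : κ * (y (T s) ^ 2 * w (T s)) ^ 2 / (y (T s) ^ 4 * ∏ i ∈ I, (1 + a i * w (T s)))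
          = (A * w (T s) ^ 2 / ∏ i ∈ I, (1 + a i * w (T s))) / 4 := by
        rw [hκA]
        generalize (∏ i ∈ I, (1 + a i * w (T s))) = P at *
        field_simp
      rw [h7]
      generalize (∏ i ∈ I, (1 + a i * w (T s))) = P at *
      have h8 : 1 / 4 - A * w (T s) ^ 2 / P / 4 = (P - A * w (T s) ^ 2) / (4 * P) := by
        field_simp
      rw [h8]
      calc (P - A * w (T s) ^ 2) / (4 * P) ≤ (P - A * w (T s) ^ 2) / (4 * (A * w (T s) ^ 2)) :=
            div_le_div_of_nonneg_left (by linarith) (by positivity) (by linarith)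
        _ ≤ (B * w (T s)) / (4 * (A * w (T s) ^ 2)) :=
            div_le_div_of_nonneg_right (by linarith) (by positivity)
        _ = _ := by field_simp) (by
      filter_upwards [hT.eventually ((h.v_tendsto (by omega)).eventually_lt_const one_pos),
        hT.eventually h.y_pos, hT.eventually h.w_pos, hwT] with s h1 h2 h3 h4
      have hv : 1 < y (T s) * w (T s) := by
        have := (inv_lt_one₀ (by positivity)).1 h1
        exact this
      rw [Real.exp_neg, ← h4, inv_le_iff_one_le_mul₀ h3]
      nlinarith)
  -- `h' = -(p - 1/2) / h` for `h = √(y² w)`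
  have hG := htr (fun t => (-l t * (y t ^ 2 * w t) - 1 / 2) / √(y t ^ 2 * w t)) _ hlim
  have hsqrt0 : Tendsto (fun t => √(y t ^ 2 * w t)) (𝓝[<] b) (𝓝 0) := by
    simpa using h.H_tendsto.sqrt
  have hp : Tendsto (fun t => -l t * (y t ^ 2 * w t)) (𝓝[<] b) (𝓝 (1 / 2)) := by
    have h1 := (hG.mul hsqrt0).add_const (1 / 2)
    rw [mul_zero, zero_add] at h1
    refine h1.congr' ?_
    filter_upwards [h.H_pos] with t ht
    rw [div_mul_cancel₀ _ (Real.sqrt_pos.2 ht).ne']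
    ring
  have hroot : Tendsto (fun t => √(y t ^ 2 * w t) / (b - t)) (𝓝[<] b) (𝓝 ℓ) := by
    refine HasDerivAt.lhopital_zero_nhdsLT (by
      filter_upwards [h.H_deriv, h.H_pos] with t h1 h2 using h1.sqrt h2.ne')
      (Eventually.of_forall fun t => (hasDerivAt_id t).const_sub b)
      (Eventually.of_forall fun t => by norm_num) hsqrt0 (tendsto_sub_nhdsLT b) ?_
    refine hG.congr fun t => ?_
    ring
  have hH : Tendsto (fun t => y t ^ 2 * w t / (b - t) ^ 2) (𝓝[<] b) (𝓝 (ℓ ^ 2)) := by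
    refine (hroot.pow 2).congr' ?_
    filter_upwards [h.H_pos] with t ht
    rw [div_pow, Real.sq_sqrt ht.le]
  have hℓ2 : ℓ ^ 2 ≠ 0 := by positivity
  have hl : Tendsto (fun t => (b - t) ^ 2 * l t) (𝓝[<] b) (𝓝 (-(1 / (2 * ℓ ^ 2)))) := by
    have h1 := (hp.div hH hℓ2).neg
    have h2 : -((1 / 2 : ℝ) / ℓ ^ 2) = -(1 / (2 * ℓ ^ 2)) := by ring
    rw [h2] at h1
    refine h1.congr' ?_
    filter_upwards [h.H_pos] with t ht
    simp only [Pi.div_apply]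
    rw [div_div_eq_mul_div, neg_mul, neg_mul, neg_div, neg_neg, div_eq_iff ht.ne']
    ring
  refine ⟨1 / (2 * ℓ ^ 2), by positivity, hl, fun α hα => ?_, ?_⟩
  · have h1 := hl.add ((hH.inv₀ hℓ2).mul (h.ratio_tendsto hα))
    have h2 : -(1 / (2 * ℓ ^ 2)) + (ℓ ^ 2)⁻¹ * 1 = 1 / (2 * ℓ ^ 2) := by
      field_simp
      norm_num
    rw [h2] at h1
    refine h1.congr' ?_
    filter_upwards [h.y_pos, h.w_pos] with t h4 h5
    have : 1 + α * w t ≠ 0 := by positivity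
    rw [inv_div]
    field_simp
  · have h1 := hX.div (hH.pow 2) (pow_ne_zero 2 hℓ2)
    have h2 : (1 / 4 : ℝ) / (ℓ ^ 2) ^ 2 = (1 / (2 * ℓ ^ 2)) ^ 2 := by
      field_simp
      norm_num
    rw [h2] at h1
    refine h1.congr' ?_
    filter_upwards [h.H_pos, self_mem_nhdsWithin] with t h3 h4
    have h5 : b - t ≠ 0 := sub_ne_zero.2 (ne_of_gt h4)
    simp only [Pi.div_apply]
    generalize (y t ^ 4 * ∏ i ∈ I, (1 + a i * w t)) = Q
    generalize y t ^ 2 * w t = H at *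
    field_simp

/-! ### Three or more smallest components -/

theorem supercritical (h : CollapsingFlow n κ K I a b l y w) (hn : 2 ≤ n)
    (hcard : I.card + 3 ≤ n) :
    n < 2 * I.card ∧
    Tendsto (fun t => κ * (y t ^ 2 * w t) ^ 2 / (y t ^ n * ∏ i ∈ I, (1 + a i * w t)))
      (𝓝[<] b) (𝓝 ((((I.card : ℝ) - 2) / (n - 4)) * (1 - ((I.card : ℝ) - 2) / (n - 4)))) ∧
    Tendsto (fun t => -l t * (y t ^ 2 * w t)) (𝓝[<] b) (𝓝 (((I.card : ℝ) - 2) / (n - 4))) := by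
  have hn5 : 5 ≤ n := by
    rcases h.five_le_or hn (by omega) with h1 | h1 <;> omega
  have hn5' : (5 : ℝ) ≤ n := by exact_mod_cast hn5
  have hN : (0 : ℝ) < (n : ℝ) - 4 := by linarith
  have hcard' : (I.card : ℝ) + 3 ≤ n := by exact_mod_cast hcard
  obtain ⟨T, hT, hTd, hwT, htr, hflow, hXd⟩ := h.exists_phaseFlow
  have hδ0 : ∀ᶠ s in atTop, 0 ≤ ∑ i ∈ I, 1 / (1 + a i * w (T s)) := by
    filter_upwards [hT.eventually h.w_pos] with s h1
    refine Finset.sum_nonneg fun i hi => ?_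
    have := h.a_pos i hi
    positivity
  have hlt : n < 2 * I.card := by
    by_contra hcon
    push Not at hcon
    have hcon' : 2 * (I.card : ℝ) ≤ n := by exact_mod_cast hcon
    refine hflow.not_growing_weight hN (γ := fun s => (n : ℝ) / 2 - I.card
      + ∑ i ∈ I, 1 / (1 + a i * w (T s))) ?_ ?_
    · filter_upwards [hδ0] with s hs
      linarith
    · filter_upwards [hXd] with s hs
      refine hs.congr_deriv ?_
      ring
  have hlt' : (n : ℝ) < 2 * I.card := by exact_mod_cast hlt
  have hX := hflow.tendsto_of_damped (β := ((I.card : ℝ) - 2) / (n - 4)) (B := b)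
    (D := ∑ i ∈ I, 1 / a i) (δ := fun s => ∑ i ∈ I, 1 / (1 + a i * w (T s))) hN
    (by rw [lt_div_iff₀ hN]; linarith) (by rw [div_lt_one hN]; linarith) hTd
    ((hT.eventually self_mem_nhdsWithin).mono fun s hs => le_of_lt hs) hδ0 (by
      filter_upwards [hT.eventually h.w_pos, hwT] with s h1 h2
      rw [Real.exp_neg, ← h2, Finset.sum_mul]
      refine Finset.sum_le_sum fun i hi => ?_
      have := h.a_pos i hi
      rw [← div_eq_mul_inv, div_div]
      refine div_le_div_of_nonneg_left zero_le_one (by positivity) (by linarith)) (by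
      filter_upwards [hXd] with s hs
      refine hs.congr_deriv ?_
      field_simp
      ring)
  refine ⟨hlt, htr _ _ hX, htr _ _ ?_⟩
  set β := ((I.card : ℝ) - 2) / (n - 4)
  have hβ : 1 / 2 < β := by rw [lt_div_iff₀ hN]; linarith
  have hsq : 1 / 4 - β * (1 - β) = (β - 1 / 2) ^ 2 := by ring
  have hpos : 0 < β - 1 / 2 := by linarith
  have := hflow.tendsto_of_tendsto (by nlinarith) hX
  rw [hsq, Real.sqrt_sq hpos.le] at this
  simpa using this

end CollapsingFlow

/-! ### Primitives and constants of motion -/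

theorem tendsto_of_deriv_tendsto {b c : ℝ} {f f' : ℝ → ℝ}
    (hf : ∀ᶠ t in 𝓝[<] b, HasDerivAt f (f' t) t) (hc : Tendsto f' (𝓝[<] b) (𝓝 c)) :
    ∃ d, Tendsto f (𝓝[<] b) (𝓝 d) := by
  have hlin : ∀ r : ℝ, ∀ᶠ t in 𝓝[<] b, HasDerivAt (fun t => r * t) (r * 1) t := fun r =>
    Eventually.of_forall fun t => (hasDerivAt_id t).const_mul r
  have hlim : ∀ r : ℝ, Tendsto (fun t => r * t) (𝓝[<] b) (𝓝 (r * b)) := fun r =>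
    tendsto_nhdsWithin_of_tendsto_nhds ((continuous_const.mul continuous_id).tendsto b)
  obtain ⟨C, hC⟩ := exists_le_add_of_deriv_le hf (hlin (c + 1)) (by
    filter_upwards [hc.eventually_lt_const (lt_add_one c)] with t ht
    linarith)
  refine exists_tendsto_of_deriv_ge (M := (c + 1) * b + 1 + C) hf (hlin (c - 1)) (by
    filter_upwards [hc.eventually_const_lt (sub_one_lt c)] with t ht
    linarith) (hlim (c - 1)) ?_
  filter_upwards [hC, (hlim (c + 1)).eventually_lt_const (lt_add_one _)] with t h1 h2
  linarith

theorem eq_of_hasDerivAt_zero {T : ℝ} {f : ℝ → ℝ} (hc : ContinuousOn f (Set.Ico 0 T))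
    (hd : ∀ t ∈ Set.Ioo 0 T, HasDerivAt f 0 t) {t : ℝ} (ht : t ∈ Set.Ico 0 T) : f t = f 0 := by
  have h0 : (0 : ℝ) ∈ Set.Ico 0 T := ⟨le_rfl, ht.1.trans_lt ht.2⟩
  have hd' : ∀ x ∈ interior (Set.Ico 0 T), HasDerivWithinAt f ((fun _ => (0 : ℝ)) x)
      (interior (Set.Ico 0 T)) x := fun x hx => by
    rw [interior_Ico] at hx
    exact (hd x hx).hasDerivWithinAt
  exact le_antisymm
    (antitoneOn_of_hasDerivWithinAt_nonpos (convex_Ico 0 T) hc hd' (fun _ _ => le_rfl) h0 ht ht.1)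
    (monotoneOn_of_hasDerivWithinAt_nonneg (convex_Ico 0 T) hc hd' (fun _ _ => le_rfl) h0 ht ht.1)

theorem hasDerivAt_primitive {T : ℝ} {f : ℝ → ℝ} (hf : ContinuousOn f (Set.Ico 0 T)) {t : ℝ}
    (ht : t ∈ Set.Ioo 0 T) : HasDerivAt (fun t => ∫ s in (0 : ℝ)..t, f s) (f t) t := by
  have hsub : Set.uIcc 0 t ⊆ Set.Ico 0 T := by
    rw [Set.uIcc_of_le ht.1.le]
    exact Set.Icc_subset_Ico_right ht.2
  have hIoo : ContinuousOn f (Set.Ioo 0 T) := hf.mono Set.Ioo_subset_Ico_self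
  exact intervalIntegral.integral_hasDerivAt_right (hf.mono hsub).intervalIntegrable
    (hIoo.stronglyMeasurableAtFilter isOpen_Ioo t ht) (hIoo.continuousAt (Ioo_mem_nhds ht.1 ht.2))

theorem continuousOn_primitive {T : ℝ} {f : ℝ → ℝ} (hf : ContinuousOn f (Set.Ico 0 T)) :
    ContinuousOn (fun t => ∫ s in (0 : ℝ)..t, f s) (Set.Ico 0 T) := by
  intro t ht
  obtain ⟨t', h1, h2⟩ := exists_between ht.2
  have h0 : (0 : ℝ) ≤ t' := ht.1.trans h1.le
  have hc := intervalIntegral.continuousOn_primitive_interval (a := 0) (b := t') (f := f)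
    (μ := MeasureTheory.volume) (by
      rw [Set.uIcc_of_le h0]
      exact (hf.mono (Set.Icc_subset_Ico_right h2)).integrableOn_Icc)
  rw [Set.uIcc_of_le h0] at hc
  refine (hc t ⟨ht.1, h1.le⟩).mono_of_mem_nhdsWithin ?_
  filter_upwards [self_mem_nhdsWithin, mem_nhdsWithin_of_mem_nhds (Iio_mem_nhds h1)] with s hs hs'
    using ⟨hs.1, le_of_lt hs'⟩

/-- The solution `y = exp ∫₀ᵗ f` of `y' = f y`, `y(0) = 1`. -/
noncomputable def expPrimitive (f : ℝ → ℝ) (t : ℝ) : ℝ := Real.exp (∫ s in (0 : ℝ)..t, f s)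

/-- The integral `w = ∫₀ᵗ y⁻²`; then `y w` is a second solution of the linear equation solved by
`y = expPrimitive f`, with unit Wronskian. -/
noncomputable def wronskianRatio (f : ℝ → ℝ) (t : ℝ) : ℝ :=
  ∫ s in (0 : ℝ)..t, 1 / expPrimitive f s ^ 2

theorem expPrimitive_pos (f : ℝ → ℝ) (t : ℝ) : 0 < expPrimitive f t := Real.exp_pos _

theorem expPrimitive_zero (f : ℝ → ℝ) : expPrimitive f 0 = 1 := by simp [expPrimitive]

theorem wronskianRatio_zero (f : ℝ → ℝ) : wronskianRatio f 0 = 0 := by simp [wronskianRatio]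

section Primitive

variable {T : ℝ} {f : ℝ → ℝ}

theorem expPrimitive_continuousOn (hf : ContinuousOn f (Set.Ico 0 T)) :
    ContinuousOn (expPrimitive f) (Set.Ico 0 T) := (continuousOn_primitive hf).rexp

theorem expPrimitive_hasDerivAt (hf : ContinuousOn f (Set.Ico 0 T)) {t : ℝ}
    (ht : t ∈ Set.Ioo 0 T) : HasDerivAt (expPrimitive f) (f t * expPrimitive f t) t := by
  refine (hasDerivAt_primitive hf ht).exp.congr_deriv ?_
  rw [mul_comm]
  rfl

theorem inv_sq_expPrimitive_continuousOn (hf : ContinuousOn f (Set.Ico 0 T)) :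
    ContinuousOn (fun s => 1 / expPrimitive f s ^ 2) (Set.Ico 0 T) :=
  continuousOn_const.div ((expPrimitive_continuousOn hf).pow 2)
    fun s _ => (pow_pos (expPrimitive_pos f s) 2).ne'

theorem wronskianRatio_continuousOn (hf : ContinuousOn f (Set.Ico 0 T)) :
    ContinuousOn (wronskianRatio f) (Set.Ico 0 T) :=
  continuousOn_primitive (inv_sq_expPrimitive_continuousOn hf)

theorem wronskianRatio_hasDerivAt (hf : ContinuousOn f (Set.Ico 0 T)) {t : ℝ}
    (ht : t ∈ Set.Ioo 0 T) : HasDerivAt (wronskianRatio f) (1 / expPrimitive f t ^ 2) t :=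
  hasDerivAt_primitive (inv_sq_expPrimitive_continuousOn hf) ht

theorem wronskianRatio_nonneg {t : ℝ} (ht : 0 ≤ t) : 0 ≤ wronskianRatio f t :=
  intervalIntegral.integral_nonneg ht fun s _ => by positivity

theorem wronskianRatio_pos (hf : ContinuousOn f (Set.Ico 0 T)) {t : ℝ}
    (ht : t ∈ Set.Ioo 0 T) : 0 < wronskianRatio f t := by
  have hmono : StrictMonoOn (wronskianRatio f) (Set.Ico 0 T) := by
    refine strictMonoOn_of_deriv_pos (convex_Ico 0 T) (wronskianRatio_continuousOn hf)
      fun s hs => ?_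
    rw [interior_Ico] at hs
    rw [(wronskianRatio_hasDerivAt hf hs).deriv]
    have := expPrimitive_pos f s
    positivity
  rw [← wronskianRatio_zero f]
  exact hmono ⟨le_rfl, ht.1.trans ht.2⟩ ⟨ht.1.le, ht.2⟩ ht.1

end Primitive

namespace IsREPSolution

variable {n : ℕ} {k c_b ρ₀ : ℝ} {lam0 : ℕ → ℝ} {T : ℝ} {lam : ℕ → ℝ → ℝ} {ρ : ℝ → ℝ}

/-- The Wronskian of two components is constant. -/
theorem sub_mul_expPrimitive (h : IsREPSolution n k c_b ρ₀ lam0 T lam ρ) {i j : ℕ}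
    (hi : i ∈ Finset.Icc 1 n) (hj : j ∈ Finset.Icc 1 n) {t : ℝ} (ht : t ∈ Set.Ico 0 T) :
    (lam i t - lam j t) * (expPrimitive (lam i) t * expPrimitive (lam j) t) = lam0 i - lam0 j := by
  have hci := h.lam_cont i hi
  have hcj := h.lam_cont j hj
  have := eq_of_hasDerivAt_zero (f := fun t => (lam i t - lam j t) *
    (expPrimitive (lam i) t * expPrimitive (lam j) t))
    ((hci.sub hcj).mul ((expPrimitive_continuousOn hci).mul (expPrimitive_continuousOn hcj)))
    (fun s hs => by
      refine (((h.lam_deriv i hi s hs).sub (h.lam_deriv j hj s hs)).mul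
        ((expPrimitive_hasDerivAt hci hs).mul (expPrimitive_hasDerivAt hcj hs))).congr_deriv ?_
      simp only [Pi.sub_apply, Pi.mul_apply]
      ring) ht
  simp only [expPrimitive_zero, h.lam_init i hi, h.lam_init j hj] at this
  linarith

/-- All the functions `exp ∫ λᵢ` solve the same linear second order equation, so each of them is
determined by the first one and its initial slope. -/
theorem expPrimitive_eq (h : IsREPSolution n k c_b ρ₀ lam0 T lam ρ) {i j : ℕ}
    (hi : i ∈ Finset.Icc 1 n) (hj : j ∈ Finset.Icc 1 n) {t : ℝ} (ht : t ∈ Set.Ico 0 T) :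
    expPrimitive (lam i) t = expPrimitive (lam j) t *
      (1 + (lam0 i - lam0 j) * wronskianRatio (lam j) t) := by
  have hci := h.lam_cont i hi
  have hcj := h.lam_cont j hj
  have := eq_of_hasDerivAt_zero (f := fun t => expPrimitive (lam i) t / expPrimitive (lam j) t -
    (lam0 i - lam0 j) * wronskianRatio (lam j) t)
    (((expPrimitive_continuousOn hci).div (expPrimitive_continuousOn hcj)
      fun s _ => (expPrimitive_pos _ s).ne').sub
      (continuousOn_const.mul (wronskianRatio_continuousOn hcj)))
    (fun s hs => by
      have hp := expPrimitive_pos (lam j) s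
      refine (((expPrimitive_hasDerivAt hci hs).div (expPrimitive_hasDerivAt hcj hs) hp.ne').sub
        ((wronskianRatio_hasDerivAt hcj hs).const_mul _)).congr_deriv ?_
      have hw := h.sub_mul_expPrimitive hi hj (Set.Ioo_subset_Ico_self hs)
      rw [← hw]
      field_simp
      ring) ht
  simp only [expPrimitive_zero, wronskianRatio_zero] at this
  have hp := expPrimitive_pos (lam j) t
  rw [sub_eq_iff_eq_add, div_eq_iff hp.ne'] at this
  rw [this]
  ring

theorem component_eq (h : IsREPSolution n k c_b ρ₀ lam0 T lam ρ) {i j : ℕ}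
    (hi : i ∈ Finset.Icc 1 n) (hj : j ∈ Finset.Icc 1 n) {t : ℝ} (ht : t ∈ Set.Ico 0 T) :
    lam i t = lam j t + (lam0 i - lam0 j) / (expPrimitive (lam j) t ^ 2 *
      (1 + (lam0 i - lam0 j) * wronskianRatio (lam j) t)) := by
  have h1 := h.sub_mul_expPrimitive hi hj ht
  have h2 := h.expPrimitive_eq hi hj ht
  have hp := expPrimitive_pos (lam j) t
  have h3 : expPrimitive (lam i) t * expPrimitive (lam j) t = expPrimitive (lam j) t ^ 2 *
      (1 + (lam0 i - lam0 j) * wronskianRatio (lam j) t) := by rw [h2]; ring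
  rw [← sub_eq_iff_eq_add', eq_div_iff, ← h3, h1]
  rw [← h3]
  exact (mul_pos (expPrimitive_pos _ t) hp).ne'

theorem ρ_mul_prod (h : IsREPSolution n k c_b ρ₀ lam0 T lam ρ) {t : ℝ} (ht : t ∈ Set.Ico 0 T) :
    ρ t * ∏ i ∈ Finset.Icc 1 n, expPrimitive (lam i) t = ρ₀ := by
  have hprod : ∀ t, ∏ i ∈ Finset.Icc 1 n, expPrimitive (lam i) t =
      Real.exp (∑ i ∈ Finset.Icc 1 n, ∫ s in (0 : ℝ)..t, lam i s) := fun t => by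
    rw [Real.exp_sum]
    rfl
  have := eq_of_hasDerivAt_zero (f := fun t => ρ t *
      Real.exp (∑ i ∈ Finset.Icc 1 n, ∫ s in (0 : ℝ)..t, lam i s))
    (h.ρ_cont.mul (continuousOn_finsetSum _ fun i hi =>
      continuousOn_primitive (h.lam_cont i hi)).rexp)
    (fun s hs => by
      have hs1 : HasDerivAt (fun t => ∑ i ∈ Finset.Icc 1 n, ∫ s in (0 : ℝ)..t, lam i s)
          (∑ i ∈ Finset.Icc 1 n, lam i s) s :=
        HasDerivAt.fun_sum fun i hi => hasDerivAt_primitive (h.lam_cont i hi) hs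
      refine ((h.ρ_deriv s hs).mul hs1.exp).congr_deriv ?_
      ring) ht
  rw [hprod, this]
  simp [h.ρ_init]

variable {J : ℕ}

theorem ρ_eq (h : IsREPSolution n k c_b ρ₀ lam0 T lam ρ) (hJ : InitialOrder n J lam0)
    {t : ℝ} (ht : t ∈ Set.Ico 0 T) :
    ρ t = ρ₀ / (expPrimitive (lam 1) t ^ n *
      ∏ i ∈ Finset.Ioc J n, (1 + (lam0 i - lam0 1) * wronskianRatio (lam 1) t)) := by
  have h1n : 1 ∈ Finset.Icc 1 n := Finset.mem_Icc.2 ⟨le_rfl, hJ.one_le.trans hJ.le_n⟩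
  have hprod : ∏ i ∈ Finset.Icc 1 n, expPrimitive (lam i) t = expPrimitive (lam 1) t ^ n *
      ∏ i ∈ Finset.Ioc J n, (1 + (lam0 i - lam0 1) * wronskianRatio (lam 1) t) := by
    rw [Finset.prod_congr rfl fun i hi => h.expPrimitive_eq hi h1n ht, Finset.prod_mul_distrib,
      Finset.prod_const, Nat.card_Icc, Nat.add_sub_cancel]
    congr 1
    symm
    refine Finset.prod_subset (fun i hi => ?_) (fun i hi hi' => ?_)
    · rw [Finset.mem_Ioc] at hi
      exact Finset.mem_Icc.2 ⟨by have := hJ.one_le; omega, hi.2⟩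
    · rw [Finset.mem_Icc] at hi
      rw [Finset.mem_Ioc] at hi'
      rw [hJ.eq_first i hi.1 (by omega)]
      ring
  rw [← hprod]
  refine eq_div_of_mul_eq (Finset.prod_pos fun i _ => expPrimitive_pos _ t).ne' ?_
  exact h.ρ_mul_prod ht

theorem ρ_pos (h : IsREPSolution n k c_b ρ₀ lam0 T lam ρ) (hρ₀ : 0 < ρ₀) {t : ℝ}
    (ht : t ∈ Set.Ico 0 T) : 0 < ρ t := by
  have := h.ρ_mul_prod ht
  rw [← this] at hρ₀
  exact pos_of_mul_pos_left hρ₀ (Finset.prod_pos fun i _ => expPrimitive_pos _ t).le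

end IsREPSolution

/-! ### Continuation of solutions -/

theorem hasDerivAt_piecewise {a b ε : ℝ} (hab : a < b) (hε : 0 < ε) {f f' g g' : ℝ → ℝ}
    (hf : ∀ t ∈ Set.Ioo a b, HasDerivAt f (f' t) t)
    (hg : ∀ t ∈ Set.Ioo (b - ε) (b + ε), HasDerivAt g (g' t) t)
    (hfg : Tendsto f (𝓝[<] b) (𝓝 (g b))) (hfg' : Tendsto f' (𝓝[<] b) (𝓝 (g' b))) :
    ∀ t ∈ Set.Ioo a (b + ε),
      HasDerivAt (fun t => if t < b then f t else g t) (if t < b then f' t else g' t) t := by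
  intro t ht
  rcases lt_trichotomy t b with htb | rfl | htb
  · rw [if_pos htb]
    refine (hf t ⟨ht.1, htb⟩).congr_of_eventuallyEq ?_
    filter_upwards [Iio_mem_nhds htb] with s hs using if_pos hs
  · rw [if_neg (lt_irrefl t)]
    have hd : ∀ s ∈ Set.Ioo a t, HasDerivAt (fun s => if s < t then f s else g s) (f' s) s :=
      fun s hs => (hf s hs).congr_of_eventuallyEq (by
        filter_upwards [Iio_mem_nhds hs.2] with r hr using if_pos hr)
    have hleft : HasDerivWithinAt (fun s => if s < t then f s else g s) (g' t) (Set.Iic t) t := by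
      refine hasDerivWithinAt_Iic_of_tendsto_deriv (s := Set.Ioo a t)
        (fun s hs => (hd s hs).differentiableAt.differentiableWithinAt) ?_ (Ioo_mem_nhdsLT hab) ?_
      · have : Tendsto (fun s => if s < t then f s else g s) (𝓝[<] t) (𝓝 (g t)) :=
          hfg.congr' (by filter_upwards [self_mem_nhdsWithin] with s hs using (if_pos hs).symm)
        simp only [ContinuousWithinAt, lt_irrefl, if_false]
        exact this.mono_left (nhdsWithin_mono _ fun s hs => hs.2)
      · refine hfg'.congr' ?_
        filter_upwards [Ioo_mem_nhdsLT hab] with s hs using (hd s hs).deriv.symm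
    have hright : HasDerivWithinAt (fun s => if s < t then f s else g s) (g' t) (Set.Ici t) t :=
      (hg t ⟨by linarith, by linarith⟩).hasDerivWithinAt.congr
        (fun s hs => if_neg (not_lt.2 hs)) (if_neg (lt_irrefl t))
    have := hleft.union hright
    rwa [Set.Iic_union_Ici, hasDerivWithinAt_univ] at this
  · rw [if_neg (not_lt.2 htb.le)]
    refine (hg t ⟨by linarith, ht.2⟩).congr_of_eventuallyEq ?_
    filter_upwards [Ioi_mem_nhds htb] with s hs using if_neg (not_lt.2 (le_of_lt hs))

theorem continuousOn_piecewise {b T : ℝ} (hb : 0 < b) {f g u' : ℝ → ℝ}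
    (hf : ContinuousOn f (Set.Ico 0 b))
    (hu : ∀ t ∈ Set.Ioo 0 T, HasDerivAt (fun t => if t < b then f t else g t) (u' t) t) :
    ContinuousOn (fun t => if t < b then f t else g t) (Set.Ico 0 T) := by
  intro t ht
  rcases ht.1.eq_or_lt with rfl | h0
  · have hmem : Set.Ico 0 b ∈ 𝓝[Set.Ico 0 T] (0 : ℝ) := by
      filter_upwards [self_mem_nhdsWithin, mem_nhdsWithin_of_mem_nhds (Iio_mem_nhds hb)]
        with s hs hs' using ⟨hs.1, hs'⟩
    refine ((hf 0 ⟨le_rfl, hb⟩).mono_of_mem_nhdsWithin hmem).congr_of_eventuallyEq ?_ (if_pos hb)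
    filter_upwards [hmem] with s hs using if_pos hs.2
  · exact (hu t ⟨h0, ht.2⟩).continuousAt.continuousWithinAt

/-- A maximal solution cannot converge at the end of its interval of existence. -/
theorem IsMaximalREPSolution.not_tendsto {n : ℕ} {k c_b ρ₀ : ℝ} {lam0 : ℕ → ℝ} {T : ℝ}
    {lam : ℕ → ℝ → ℝ} {ρ : ℝ → ℝ} (h : IsMaximalREPSolution n k c_b ρ₀ lam0 T lam ρ) (hT : 0 < T)
    {ℓ : ℕ → ℝ} {r : ℝ} (hl : ∀ i ∈ Finset.Icc 1 n, Tendsto (lam i) (𝓝[<] T) (𝓝 (ℓ i)))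
    (hr : Tendsto ρ (𝓝[<] T) (𝓝 r)) : False := by
  obtain ⟨hs, hmax⟩ := h
  let V : (Finset.Icc 1 n → ℝ) × ℝ → (Finset.Icc 1 n → ℝ) × ℝ := fun x =>
    (fun i => -(x.1 i) ^ 2 + k / (n : ℝ) * (x.2 - c_b), -x.2 * ∑ i, x.1 i)
  have hV : ContDiff ℝ 1 V := by
    refine ContDiff.prodMk (contDiff_pi.2 fun i => ?_) ?_ <;> fun_prop
  obtain ⟨α, hα0, ε, hε, hα⟩ := (hV.contDiffAt (x := ((fun i => ℓ i, r) :
    (Finset.Icc 1 n → ℝ) × ℝ))).exists_forall_mem_closedBall_exists_eq_forall_mem_Ioo_hasDerivAt₀ T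
  have hα1 : ∀ i : Finset.Icc 1 n, ∀ t ∈ Set.Ioo (T - ε) (T + ε),
      HasDerivAt (fun t => (α t).1 i) (-((α t).1 i) ^ 2 + k / (n : ℝ) * ((α t).2 - c_b)) t :=
    fun i t ht => (hasDerivAt_pi.1 (hα t ht).fst) i
  have hα2 : ∀ t ∈ Set.Ioo (T - ε) (T + ε),
      HasDerivAt (fun t => (α t).2) (-(α t).2 * ∑ i, (α t).1 i) t :=
    fun t ht => (hα t ht).snd
  let β : ℕ → ℝ → ℝ := fun i t => if hi : i ∈ Finset.Icc 1 n then (α t).1 ⟨i, hi⟩ else 0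
  have hβ : ∀ i (hi : i ∈ Finset.Icc 1 n), β i = fun t => (α t).1 ⟨i, hi⟩ := fun i hi => by
    funext t
    exact dif_pos hi
  have hsum : ∀ t, ∑ i, (α t).1 i = ∑ i ∈ Finset.Icc 1 n, β i t := fun t => by
    rw [← Finset.sum_coe_sort (Finset.Icc 1 n)]
    refine Finset.sum_congr rfl fun i _ => ?_
    rw [hβ i i.2]
  have hβT : ∀ i ∈ Finset.Icc 1 n, β i T = ℓ i := fun i hi => by
    rw [hβ i hi]
    simp only [hα0]
  have hαT : (α T).2 = r := by rw [hα0]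
  have hTT : T ∈ Set.Ioo (T - ε) (T + ε) := ⟨by linarith, by linarith⟩
  have hlam : ∀ i ∈ Finset.Icc 1 n, ∀ t ∈ Set.Ioo 0 (T + ε),
      HasDerivAt (fun t => if t < T then lam i t else β i t)
        (if t < T then -(lam i t) ^ 2 + k / (n : ℝ) * (ρ t - c_b)
          else -(β i t) ^ 2 + k / (n : ℝ) * ((α t).2 - c_b)) t := by
    intro i hi
    refine hasDerivAt_piecewise hT hε
      (f' := fun t => -(lam i t) ^ 2 + k / (n : ℝ) * (ρ t - c_b))
      (g' := fun t => -(β i t) ^ 2 + k / (n : ℝ) * ((α t).2 - c_b))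
      (hs.lam_deriv i hi) (fun t ht => ?_) ?_ ?_
    · rw [hβ i hi]
      exact hα1 ⟨i, hi⟩ t ht
    · rw [hβT i hi]
      exact hl i hi
    · simp only [hβT i hi, hαT]
      exact ((hl i hi).pow 2).neg.add ((hr.sub_const c_b).const_mul _)
  have hρ : ∀ t ∈ Set.Ioo 0 (T + ε), HasDerivAt (fun t => if t < T then ρ t else (α t).2)
      (if t < T then -(ρ t) * ∑ i ∈ Finset.Icc 1 n, lam i t
        else -(α t).2 * ∑ i ∈ Finset.Icc 1 n, β i t) t := by
    refine hasDerivAt_piecewise hT hε (g := fun t => (α t).2)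
      (f' := fun t => -(ρ t) * ∑ i ∈ Finset.Icc 1 n, lam i t)
      (g' := fun t => -(α t).2 * ∑ i ∈ Finset.Icc 1 n, β i t)
      hs.ρ_deriv (fun t ht => ?_) ?_ ?_
    · rw [← hsum]
      exact hα2 t ht
    · simp only [hαT]
      exact hr
    · simp only [hαT]
      rw [Finset.sum_congr rfl hβT]
      exact hr.neg.mul (tendsto_finsetSum _ fun i hi => hl i hi)
  refine hmax (T + ε) (by linarith) ⟨fun i t => if t < T then lam i t else β i t,
    fun t => if t < T then ρ t else (α t).2, ?_, ?_, ?_, ?_, ?_, ?_⟩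
  · exact fun i hi => continuousOn_piecewise hT (hs.lam_cont i hi) (hlam i hi)
  · exact continuousOn_piecewise hT hs.ρ_cont hρ
  · intro i hi
    simp only [if_pos hT]
    exact hs.lam_init i hi
  · simp only [if_pos hT]
    exact hs.ρ_init
  · intro i hi t ht
    refine (hlam i hi t ht).congr_deriv ?_
    split_ifs <;> rfl
  · intro t ht
    refine (hρ t ht).congr_deriv ?_
    split_ifs <;> rfl

/-! ### The smallest component tends to minus infinity -/

/-- A function with `f' ≥ -f² - K` has a limit in `[-∞, ∞]` at a finite time, since
`(arctan f)' ≥ -(1 + K)`. -/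
theorem tendsto_of_riccati {b K : ℝ} {f f' : ℝ → ℝ} (hK : 0 ≤ K)
    (hf : ∀ᶠ t in 𝓝[<] b, HasDerivAt f (f' t) t)
    (h : ∀ᶠ t in 𝓝[<] b, -(f t) ^ 2 - K ≤ f' t) :
    Tendsto f (𝓝[<] b) atTop ∨ Tendsto f (𝓝[<] b) atBot ∨ ∃ c, Tendsto f (𝓝[<] b) (𝓝 c) := by
  obtain ⟨α, hα⟩ := exists_tendsto_of_deriv_ge (f := fun t => Real.arctan (f t))
    (g := fun t => -(1 + K) * t) (g' := fun t => -(1 + K) * 1) (M := Real.pi / 2)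
    (hf.mono fun t ht => ht.arctan)
    (Eventually.of_forall fun t => (hasDerivAt_id t).const_mul _) (by
      filter_upwards [h] with t ht
      have h1 : 0 < 1 + f t ^ 2 := by positivity
      rw [div_mul_eq_mul_div, one_mul, le_div_iff₀ h1]
      nlinarith [mul_nonneg hK (sq_nonneg (f t))])
    (tendsto_nhdsWithin_of_tendsto_nhds ((continuous_const.mul continuous_id).tendsto b))
    (Eventually.of_forall fun t => (Real.arctan_lt_pi_div_two _).le)
  have h1 : α ≤ Real.pi / 2 :=
    le_of_tendsto hα (Eventually.of_forall fun t => (Real.arctan_lt_pi_div_two _).le)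
  have h2 : -(Real.pi / 2) ≤ α :=
    ge_of_tendsto hα (Eventually.of_forall fun t => (Real.neg_pi_div_two_lt_arctan _).le)
  rcases h1.eq_or_lt with rfl | h1
  · left
    refine (Real.tendsto_tan_pi_div_two.comp (tendsto_nhdsWithin_iff.2 ⟨hα, Eventually.of_forall
      fun t => Real.arctan_lt_pi_div_two _⟩)).congr fun t => ?_
    simp [Real.tan_arctan]
  · right
    rcases h2.eq_or_lt with h2 | h2
    · left
      rw [← h2] at hα
      refine (Real.tendsto_tan_neg_pi_div_two.comp (tendsto_nhdsWithin_iff.2 ⟨hα,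
        Eventually.of_forall fun t => Real.neg_pi_div_two_lt_arctan _⟩)).congr fun t => ?_
      simp [Real.tan_arctan]
    · right
      have hcos : Real.cos α ≠ 0 := (Real.cos_pos_of_mem_Ioo ⟨h2, h1⟩).ne'
      refine ⟨Real.tan α, ((Real.continuousAt_tan.2 hcos).tendsto.comp hα).congr fun t => ?_⟩
      simp [Real.tan_arctan]

namespace IsREPSolution

variable {n J : ℕ} {k c_b ρ₀ : ℝ} {lam0 : ℕ → ℝ} {T : ℝ} {lam : ℕ → ℝ → ℝ} {ρ : ℝ → ℝ}

theorem lam_le (h : IsREPSolution n k c_b ρ₀ lam0 T lam ρ) (hJ : InitialOrder n J lam0)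
    {i : ℕ} (hi : i ∈ Finset.Icc 1 n) {t : ℝ} (ht : t ∈ Set.Ico 0 T) : lam 1 t ≤ lam i t := by
  have h1n : 1 ∈ Finset.Icc 1 n := Finset.mem_Icc.2 ⟨le_rfl, hJ.one_le.trans hJ.le_n⟩
  have h1 := h.sub_mul_expPrimitive hi h1n ht
  have h2 : 0 ≤ lam0 i - lam0 1 := by
    rw [Finset.mem_Icc] at hi
    rcases le_or_gt i J with hiJ | hiJ
    · rw [hJ.eq_first i hi.1 hiJ, sub_self]
    · exact sub_nonneg.2 (hJ.first_lt i hiJ hi.2).le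
  rw [← h1] at h2
  exact sub_nonneg.1 (nonneg_of_mul_nonneg_left h2
    (mul_pos (expPrimitive_pos _ t) (expPrimitive_pos _ t)))

/-- If `y = exp ∫ λ₁` has a positive limit, so have `w`, all components of the form
`λ₁ + a / (y² (1 + a w))`, and the density. -/
theorem tendsto_of_primitive_tendsto (h : IsREPSolution n k c_b ρ₀ lam0 T lam ρ)
    (hJ : InitialOrder n J lam0) (hT : 0 < T) {d : ℝ}
    (hd : Tendsto (fun t => ∫ s in (0 : ℝ)..t, lam 1 s) (𝓝[<] T) (𝓝 d)) :
    (∃ r, Tendsto ρ (𝓝[<] T) (𝓝 r)) ∧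
      ∀ c, Tendsto (lam 1) (𝓝[<] T) (𝓝 c) →
        ∀ i ∈ Finset.Icc 1 n, ∃ m, Tendsto (lam i) (𝓝[<] T) (𝓝 m) := by
  have h1n : 1 ∈ Finset.Icc 1 n := Finset.mem_Icc.2 ⟨le_rfl, hJ.one_le.trans hJ.le_n⟩
  have hc1 := h.lam_cont 1 h1n
  have hIoo : ∀ᶠ t in 𝓝[<] T, t ∈ Set.Ioo 0 T := Ioo_mem_nhdsLT hT
  have hy : Tendsto (expPrimitive (lam 1)) (𝓝[<] T) (𝓝 (Real.exp d)) :=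
    (Real.continuous_exp.tendsto d).comp hd
  have hy0 := Real.exp_pos d
  obtain ⟨W, hW⟩ := tendsto_of_deriv_tendsto
    (hIoo.mono fun t ht => wronskianRatio_hasDerivAt hc1 ht)
    ((tendsto_const_nhds (x := (1 : ℝ))).div (hy.pow 2) (by positivity))
  have hW0 : 0 ≤ W := ge_of_tendsto hW (hIoo.mono fun t ht => wronskianRatio_nonneg ht.1.le)
  have hpos : ∀ i, J < i → i ≤ n → 0 < 1 + (lam0 i - lam0 1) * W := fun i h1 h2 => by
    have := mul_nonneg (sub_nonneg.2 (hJ.first_lt i h1 h2).le) hW0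
    linarith
  constructor
  · have hlim := (tendsto_const_nhds (x := ρ₀)).div ((hy.pow n).mul
      (tendsto_finsetProd (Finset.Ioc J n) fun i _ =>
        ((hW.const_mul (lam0 i - lam0 1)).const_add 1))) (mul_pos (pow_pos hy0 n)
        (Finset.prod_pos fun i hi => hpos i (Finset.mem_Ioc.1 hi).1 (Finset.mem_Ioc.1 hi).2)).ne'
    refine ⟨_, hlim.congr' ?_⟩
    filter_upwards [hIoo] with t ht
    exact (h.ρ_eq hJ (Set.Ioo_subset_Ico_self ht)).symm
  · intro c hc i hi
    have hi0 : 0 < 1 + (lam0 i - lam0 1) * W := by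
      rw [Finset.mem_Icc] at hi
      rcases le_or_gt i J with hiJ | hiJ
      · rw [hJ.eq_first i hi.1 hiJ]
        simp
      · exact hpos i hiJ hi.2
    have hlim := hc.add ((tendsto_const_nhds (x := lam0 i - lam0 1)).div ((hy.pow 2).mul
      ((hW.const_mul (lam0 i - lam0 1)).const_add 1)) (mul_pos (pow_pos hy0 2) hi0).ne')
    refine ⟨_, hlim.congr' ?_⟩
    filter_upwards [hIoo] with t ht
    exact (h.component_eq hi h1n (Set.Ioo_subset_Ico_self ht)).symm

end IsREPSolution

namespace IsMaximalREPSolution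

variable {n J : ℕ} {k c_b ρ₀ : ℝ} {lam0 : ℕ → ℝ} {T : ℝ} {lam : ℕ → ℝ → ℝ} {ρ : ℝ → ℝ}

theorem first_tendsto_atBot (h : IsMaximalREPSolution n k c_b ρ₀ lam0 T lam ρ)
    (hJ : InitialOrder n J lam0) (hT : 0 < T) (hk : 0 < k) (hc : 0 < c_b) (hρ₀ : 0 < ρ₀) :
    Tendsto (lam 1) (𝓝[<] T) atBot := by
  have h1n : 1 ∈ Finset.Icc 1 n := Finset.mem_Icc.2 ⟨le_rfl, hJ.one_le.trans hJ.le_n⟩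
  have hs := h.1
  have hkn : 0 ≤ k / (n : ℝ) := by positivity
  have hIoo : ∀ᶠ t in 𝓝[<] T, t ∈ Set.Ioo 0 T := Ioo_mem_nhdsLT hT
  have hder := hIoo.mono fun t ht => hs.lam_deriv 1 h1n t ht
  rcases tendsto_of_riccati (K := k / n * c_b) (by positivity) hder (by
    filter_upwards [hIoo] with t ht
    have := mul_nonneg hkn (hs.ρ_pos hρ₀ (Set.Ioo_subset_Ico_self ht)).le
    linarith) with htop | hbot | ⟨c, hfin⟩
  · -- all components become positive, the density stays bounded, and so does `lam 1`
    exfalso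
    have hρ : ∀ᶠ t in 𝓝[<] T, HasDerivAt (fun t => -ρ t)
        (-(-(ρ t) * ∑ i ∈ Finset.Icc 1 n, lam i t)) t :=
      hIoo.mono fun t ht => (hs.ρ_deriv t ht).neg
    obtain ⟨s, hsρ⟩ := (eventually_eventually_le_of_deriv_nonneg hρ (by
      filter_upwards [hIoo, htop.eventually_ge_atTop 0] with t ht h0
      have hp := hs.ρ_pos hρ₀ (Set.Ioo_subset_Ico_self ht)
      have hsum : 0 ≤ ∑ i ∈ Finset.Icc 1 n, lam i t := Finset.sum_nonneg fun i hi =>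
        h0.trans (hs.lam_le hJ hi (Set.Ioo_subset_Ico_self ht))
      nlinarith [mul_nonneg hp.le hsum])).exists
    obtain ⟨C, hC⟩ := exists_le_add_of_deriv_le hder
      (g := fun t => k / n * ρ s * t) (g' := fun t => k / n * ρ s * 1)
      (Eventually.of_forall fun t => (hasDerivAt_id t).const_mul _) (by
        filter_upwards [hsρ] with t ht
        have h1 : k / n * ρ t ≤ k / n * ρ s := mul_le_mul_of_nonneg_left (by linarith) hkn
        have h2 : 0 ≤ k / n * c_b := by positivity
        nlinarith [sq_nonneg (lam 1 t)])
    have hlim : Tendsto (fun t => k / n * ρ s * t) (𝓝[<] T) (𝓝 (k / n * ρ s * T)) :=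
      tendsto_nhdsWithin_of_tendsto_nhds ((continuous_const.mul continuous_id).tendsto T)
    obtain ⟨t, h1, h2, h3⟩ := (hC.and ((hlim.eventually_lt_const (lt_add_one _)).and
      (htop.eventually_gt_atTop (k / n * ρ s * T + 1 + C)))).exists
    linarith
  · exact hbot
  · exfalso
    obtain ⟨d, hd⟩ := tendsto_of_deriv_tendsto
      (hIoo.mono fun t ht => hasDerivAt_primitive (hs.lam_cont 1 h1n) ht) hfin
    obtain ⟨⟨r, hr⟩, hcomp⟩ := hs.tendsto_of_primitive_tendsto hJ hT hd
    choose! m hm using hcomp c hfin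
    exact h.not_tendsto hT hm hr

theorem expPrimitive_tendsto (h : IsMaximalREPSolution n k c_b ρ₀ lam0 T lam ρ)
    (hJ : InitialOrder n J lam0) (hT : 0 < T) (hk : 0 < k) (hc : 0 < c_b) (hρ₀ : 0 < ρ₀) :
    Tendsto (expPrimitive (lam 1)) (𝓝[<] T) (𝓝 0) := by
  have h1n : 1 ∈ Finset.Icc 1 n := Finset.mem_Icc.2 ⟨le_rfl, hJ.one_le.trans hJ.le_n⟩
  have hs := h.1
  have hbot := h.first_tendsto_atBot hJ hT hk hc hρ₀
  have hIoo : ∀ᶠ t in 𝓝[<] T, t ∈ Set.Ioo 0 T := Ioo_mem_nhdsLT hT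
  have hΛ := hIoo.mono fun t ht => hasDerivAt_primitive (hs.lam_cont 1 h1n) ht
  refine Real.tendsto_exp_atBot.comp ?_
  by_cases hbd : ∃ M, ∀ᶠ t in 𝓝[<] T, M ≤ ∫ s in (0 : ℝ)..t, lam 1 s
  · -- `y` would have a positive limit and `y'' = (k / n) (ρ - c_b) y` a finite one
    exfalso
    obtain ⟨M, hM⟩ := hbd
    obtain ⟨d, hd⟩ := exists_tendsto_of_deriv_le hΛ (g := fun _ => 0) (g' := fun _ => 0)
      (Eventually.of_forall fun t => hasDerivAt_const t _) (hbot.eventually_le_atBot 0)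
      tendsto_const_nhds hM
    obtain ⟨⟨r, hr⟩, -⟩ := hs.tendsto_of_primitive_tendsto hJ hT hd
    have hy : Tendsto (expPrimitive (lam 1)) (𝓝[<] T) (𝓝 (Real.exp d)) :=
      (Real.continuous_exp.tendsto d).comp hd
    obtain ⟨e, he⟩ := tendsto_of_deriv_tendsto (f := fun t => lam 1 t * expPrimitive (lam 1) t)
      (f' := fun t => k / n * (ρ t - c_b) * expPrimitive (lam 1) t) (by
        filter_upwards [hIoo] with t ht
        refine ((hs.lam_deriv 1 h1n t ht).mul
          (expPrimitive_hasDerivAt (hs.lam_cont 1 h1n) ht)).congr_deriv ?_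
        ring) (((hr.sub_const c_b).const_mul _).mul hy)
    exact not_tendsto_nhds_of_tendsto_atBot (hbot.atBot_mul_pos (Real.exp_pos d) hy) _ he
  · push Not at hbd
    have hmono := eventually_eventually_le_of_deriv_nonneg (hΛ.mono fun t ht => ht.neg)
      ((hbot.eventually_le_atBot 0).mono fun t ht => neg_nonneg.2 ht)
    refine tendsto_atBot.2 fun M => ?_
    obtain ⟨s, h1, h2⟩ := ((hbd M).and_eventually hmono).exists
    filter_upwards [h2] with t ht
    simp only [Pi.neg_apply] at ht
    linarith

/-- The smallest component of a maximal solution is a collapsing flow. -/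
theorem collapsingFlow (h : IsMaximalREPSolution n k c_b ρ₀ lam0 T lam ρ)
    (hJ : InitialOrder n J lam0) (hT : 0 < T) (hk : 0 < k) (hc : 0 < c_b) (hρ₀ : 0 < ρ₀) :
    CollapsingFlow n (k / n * ρ₀) (k / n * c_b) (Finset.Ioc J n) (fun i => lam0 i - lam0 1) T
      (lam 1) (expPrimitive (lam 1)) (wronskianRatio (lam 1)) := by
  have h1n : 1 ∈ Finset.Icc 1 n := Finset.mem_Icc.2 ⟨le_rfl, hJ.one_le.trans hJ.le_n⟩
  have hn : (0 : ℝ) < n := by exact_mod_cast hJ.one_le.trans hJ.le_n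
  have hs := h.1
  have hIoo : ∀ᶠ t in 𝓝[<] T, t ∈ Set.Ioo 0 T := Ioo_mem_nhdsLT hT
  have hc1 := hs.lam_cont 1 h1n
  refine ⟨by positivity, by positivity, fun i hi => ?_, ?_, ?_, ?_, ?_, ?_,
    h.expPrimitive_tendsto hJ hT hk hc hρ₀, h.first_tendsto_atBot hJ hT hk hc hρ₀⟩
  · rw [Finset.mem_Ioc] at hi
    exact sub_pos.2 (hJ.first_lt i hi.1 hi.2)
  · exact Eventually.of_forall fun t => expPrimitive_pos _ t
  · exact hIoo.mono fun t ht => wronskianRatio_pos hc1 ht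
  · exact hIoo.mono fun t ht => expPrimitive_hasDerivAt hc1 ht
  · exact hIoo.mono fun t ht => wronskianRatio_hasDerivAt hc1 ht
  · filter_upwards [hIoo] with t ht
    refine (hs.lam_deriv 1 h1n t ht).congr_deriv ?_
    rw [hs.ρ_eq hJ (Set.Ioo_subset_Ico_self ht)]
    ring

end IsMaximalREPSolution

/-! ### Blow-up rates of the restricted Euler–Poisson system -/

theorem isBigO_of_tendsto_mul {l : Filter ℝ} {f g : ℝ → ℝ} {c : ℝ} (hg : ∀ᶠ t in l, g t ≠ 0)
    (h : Tendsto (fun t => g t * f t) l (𝓝 c)) : f =O[l] fun t => 1 / g t := by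
  refine ((h.isBigO_one ℝ).mul (isBigO_refl (fun t => 1 / g t) l)).congr' ?_ (by simp)
  filter_upwards [hg] with t ht
  field_simp

theorem isLittleO_of_tendsto_mul {l : Filter ℝ} {f g : ℝ → ℝ} (hg : ∀ᶠ t in l, g t ≠ 0)
    (h : Tendsto (fun t => g t * f t) l (𝓝 0)) : f =o[l] fun t => 1 / g t := by
  refine (((isLittleO_one_iff ℝ).2 h).mul_isBigO (isBigO_refl (fun t => 1 / g t) l)).congr' ?_
    (by simp)
  filter_upwards [hg] with t ht
  field_simp

theorem theorem1p2 (n J : ℕ) (hn : 2 ≤ n) (k c_b ρ₀ : ℝ) (hk : 0 < k) (hc : 0 < c_b)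
    (hρ₀ : 0 < ρ₀) (lam0 : ℕ → ℝ) (hJ : InitialOrder n J lam0) (tB : ℝ) (htB : 0 < tB)
    (lam : ℕ → ℝ → ℝ) (ρ : ℝ → ℝ)
    (hsol : IsMaximalREPSolution n k c_b ρ₀ lam0 tB lam ρ) :
    (J = 1 →
      2 ≤ n ∧
      Tendsto (fun t => (tB - t) * lam 1 t) (𝓝[<] tB) (𝓝 (-1)) ∧
      (∀ i, 2 ≤ i → i ≤ n → lam i =O[𝓝[<] tB] fun t => |Real.log (tB - t)|) ∧
      ρ =O[𝓝[<] tB] fun t => 1 / (tB - t)) ∧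
    (J = 2 →
      4 ≤ n ∧
      ((5 ≤ n ∧
          Tendsto (fun t => (tB - t) * lam 1 t) (𝓝[<] tB) (𝓝 (-1)) ∧
          (∀ i, 3 ≤ i → i ≤ n →
            Tendsto (fun t => (tB - t) * lam i t) (𝓝[<] tB) (𝓝 0) ∧
            Tendsto (fun t => ∫ s in (0 : ℝ)..t, lam i s) (𝓝[<] tB) atTop) ∧
          ρ =o[𝓝[<] tB] fun t => 1 / (tB - t) ^ 2) ∨
        (n = 4 ∧ k * ρ₀ < gapProduct lam0 ∧
          Tendsto (fun t => (tB - t) * lam 1 t) (𝓝[<] tB)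
            (𝓝 (-(1 / 2) - 1 / 2 * √(gapProduct lam0 / (gapProduct lam0 - k * ρ₀)))) ∧
          (∀ i, 3 ≤ i → i ≤ 4 →
            Tendsto (fun t => (tB - t) * lam i t) (𝓝[<] tB)
              (𝓝 (-(1 / 2) + 1 / 2 * √(gapProduct lam0 / (gapProduct lam0 - k * ρ₀))))) ∧
          ρ =O[𝓝[<] tB] fun t => 1 / (tB - t) ^ 2) ∨
        (n = 4 ∧ gapProduct lam0 = k * ρ₀ ∧
          ∃ C > 0,
            Tendsto (fun t => (tB - t) ^ 2 * lam 1 t) (𝓝[<] tB) (𝓝 (-C)) ∧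
            (∀ i, 3 ≤ i → i ≤ 4 →
              Tendsto (fun t => (tB - t) ^ 2 * lam i t) (𝓝[<] tB) (𝓝 C)) ∧
            Tendsto (fun t => (tB - t) ^ 4 * ρ t) (𝓝[<] tB) (𝓝 (4 / k * C ^ 2))))) ∧
    (3 ≤ J →
      2 * J < n ∧
      ∃ C > 1,
        Tendsto (fun t => (tB - t) * lam 1 t) (𝓝[<] tB) (𝓝 (-C)) ∧
        (∀ i, J + 1 ≤ i → i ≤ n →
          Tendsto (fun t => (tB - t) * lam i t) (𝓝[<] tB) (𝓝 (C - 1))) ∧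
        ρ =O[𝓝[<] tB] fun t => 1 / (tB - t) ^ 2) := by
  have hs := hsol.1
  have hF := hsol.collapsingFlow hJ htB hk hc hρ₀
  have hJn := hJ.le_n
  have hcard : (Finset.Ioc J n).card = n - J := Nat.card_Ioc J n
  have h1n : 1 ∈ Finset.Icc 1 n := Finset.mem_Icc.2 ⟨le_rfl, by omega⟩
  have hn0 : (0 : ℝ) < n := by exact_mod_cast (by omega : 0 < n)
  have hkn : k / (n : ℝ) ≠ 0 := by positivity
  have hIoo : ∀ᶠ t in 𝓝[<] tB, t ∈ Set.Ioo 0 tB := Ioo_mem_nhdsLT htB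
  have hτ : ∀ᶠ t in 𝓝[<] tB, tB - t ≠ 0 := hIoo.mono fun t ht => by linarith [ht.2]
  have hτ2 : ∀ᶠ t in 𝓝[<] tB, (tB - t) ^ 2 ≠ 0 := hτ.mono fun t ht => pow_ne_zero 2 ht
  set y := expPrimitive (lam 1)
  set w := wronskianRatio (lam 1)
  have hα : ∀ i, J < i → i ≤ n → 0 < lam0 i - lam0 1 := fun i h1 h2 =>
    sub_pos.2 (hJ.first_lt i h1 h2)
  have hlam : ∀ i, J < i → i ≤ n → (fun t => lam 1 t + (lam0 i - lam0 1) /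
      (y t ^ 2 * (1 + (lam0 i - lam0 1) * w t))) =ᶠ[𝓝[<] tB] lam i := fun i h1 h2 => by
    filter_upwards [hIoo] with t ht
    exact (hs.component_eq (Finset.mem_Icc.2 ⟨by omega, h2⟩) h1n
      (Set.Ioo_subset_Ico_self ht)).symm
  set Q : ℝ → ℝ := fun t => k / n * ρ₀ /
    (y t ^ n * ∏ i ∈ Finset.Ioc J n, (1 + (lam0 i - lam0 1) * w t))
  have hρ : ∀ᶠ t in 𝓝[<] tB, ρ t = (k / n)⁻¹ * Q t := by
    filter_upwards [hIoo] with t ht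
    rw [hs.ρ_eq hJ (Set.Ioo_subset_Ico_self ht)]
    change ρ₀ / (y t ^ n * ∏ i ∈ Finset.Ioc J n, (1 + (lam0 i - lam0 1) * w t)) =
      (k / n)⁻¹ * (k / n * ρ₀ / (y t ^ n * ∏ i ∈ Finset.Ioc J n, (1 + (lam0 i - lam0 1) * w t)))
    rw [mul_div_assoc, inv_mul_cancel_left₀ hkn]
  have hρrate : ∀ {g : ℝ → ℝ} {c : ℝ}, Tendsto (fun t => g t * Q t) (𝓝[<] tB) (𝓝 c) →
      Tendsto (fun t => g t * ρ t) (𝓝[<] tB) (𝓝 ((k / n)⁻¹ * c)) := fun {g c} hg => by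
    refine (hg.const_mul (k / n : ℝ)⁻¹).congr' ?_
    filter_upwards [hρ] with t ht
    rw [ht]
    ring
  refine ⟨?_, ?_, ?_⟩
  · rintro rfl
    have hcard1 : (Finset.Ioc 1 n).card + 1 = n := by omega
    have hp := hF.p_tendsto_one hn hcard1
    refine ⟨hn, ?_, fun i h1 h2 => ?_, ?_⟩
    · have := hF.l_rate (by norm_num) hp
      norm_num at this
      exact this
    · exact (hF.component_isBigO_log hn hcard1 (hα i (by omega) h2)).congr'
        (hlam i (by omega) h2) EventuallyEq.rfl
    · obtain ⟨c, hc'⟩ := hF.exists_density_rate_simple hn hcard1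
      exact isBigO_of_tendsto_mul hτ (hρrate hc')
  · rintro rfl
    have hcard2 : (Finset.Ioc 2 n).card + 2 = n := by omega
    rcases hF.five_le_or hn hcard2.le with hn5 | ⟨rfl, hcard4⟩
    · have hX := hF.X_tendsto_zero hn5 hcard2
      have hp := (hF.tendsto_p_of_tendsto_X hX).2 (by norm_num)
      have hroot : (1 / 2 + √(1 / 4 - 0) : ℝ) = 1 := by
        rw [show (1 / 4 - 0 : ℝ) = (1 / 2) ^ 2 by norm_num, Real.sqrt_sq (by norm_num)]
        norm_num
      rw [hroot] at hp
      refine ⟨by omega, Or.inl ⟨hn5, ?_, fun i h1 h2 => ⟨?_, ?_⟩, ?_⟩⟩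
      · have := hF.l_rate (by norm_num) hp
        norm_num at this
        exact this
      · have := hF.component_rate (by norm_num) (hα i (by omega) h2) hp
        norm_num at this
        exact this.congr' ((hlam i (by omega) h2).mono fun t ht => by simp only [← ht])
      · have hv : Tendsto (fun t => y t * w t) (𝓝[<] tB) atTop := by
          refine (tendsto_inv_nhdsGT_zero.comp (tendsto_nhdsWithin_iff.2
            ⟨hF.v_tendsto hcard2.le, ?_⟩)).congr fun t => by simp
          filter_upwards [hF.y_pos, hF.w_pos] with t h3 h4
          exact inv_pos.2 (mul_pos h3 h4)
        have hu : Tendsto (expPrimitive (lam i)) (𝓝[<] tB) atTop := by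
          refine tendsto_atTop_mono' _ ?_ (hv.const_mul_atTop (hα i (by omega) h2))
          filter_upwards [hIoo, hF.y_pos] with t ht h3
          rw [hs.expPrimitive_eq (Finset.mem_Icc.2 ⟨by omega, h2⟩) h1n
            (Set.Ioo_subset_Ico_self ht)]
          change _ ≤ y t * (1 + (lam0 i - lam0 1) * w t)
          linarith
        refine (Real.tendsto_log_atTop.comp hu).congr fun t => ?_
        simp [expPrimitive]
      · have := hρrate (hF.density_rate (by norm_num) hp hX)
        rw [zero_div, mul_zero] at this
        exact isLittleO_of_tendsto_mul hτ2 this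
    · have hprod : ∏ i ∈ Finset.Ioc 2 4, (lam0 i - lam0 1) = gapProduct lam0 := by
        rw [show Finset.Ioc 2 4 = {3, 4} from rfl, Finset.prod_pair (by norm_num), gapProduct]
        ring
      have hA : 0 < gapProduct lam0 := hprod ▸ hF.prod_a_pos
      have hX := hF.X_tendsto_four hcard4
      rw [hprod] at hX
      have hx : k / ((4 : ℕ) : ℝ) * ρ₀ / gapProduct lam0 = k * ρ₀ / gapProduct lam0 / 4 := by
        push_cast
        ring
      rw [hx] at hX
      obtain ⟨hle, hlt⟩ := hF.tendsto_p_of_tendsto_X hX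
      refine ⟨le_rfl, Or.inr ?_⟩
      have hle' : k * ρ₀ ≤ gapProduct lam0 := by
        rw [← div_le_one hA]
        linarith
      rcases hle'.lt_or_eq with hlt' | heq
      · left
        have h1 : k * ρ₀ / gapProduct lam0 < 1 := (div_lt_one hA).2 hlt'
        have hp := hlt (by linarith)
        have hd : 0 < gapProduct lam0 - k * ρ₀ := sub_pos.2 hlt'
        -- the limit of `p` is `(1 + S⁻¹) / 2`
        set S := √(gapProduct lam0 / (gapProduct lam0 - k * ρ₀)) with hS
        have hS0 : 0 < S := Real.sqrt_pos.2 (div_pos hA hd)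
        have hroot : √(1 / 4 - k * ρ₀ / gapProduct lam0 / 4) = S⁻¹ / 2 := by
          have : 1 / 4 - k * ρ₀ / gapProduct lam0 / 4 =
              (gapProduct lam0 / (gapProduct lam0 - k * ρ₀))⁻¹ / 2 ^ 2 := by
            field_simp
            norm_num
          rw [this, Real.sqrt_div (by positivity), Real.sqrt_inv, Real.sqrt_sq (by norm_num)]
        rw [hroot] at hp
        have hq : (1 : ℝ) / 2 < 1 / 2 + S⁻¹ / 2 := by
          have := inv_pos.2 hS0
          linarith
        refine ⟨rfl, hlt', ?_, fun i h2 h3 => ?_, ?_⟩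
        · have h4 : -((1 / 2 + S⁻¹ / 2) / (2 * (1 / 2 + S⁻¹ / 2) - 1)) = -(1 / 2) - 1 / 2 * S := by
            rw [show 2 * (1 / 2 + S⁻¹ / 2) - 1 = S⁻¹ by ring]
            field_simp
            ring
          rw [← h4]
          exact hF.l_rate hq hp
        · have h4 : (1 - (1 / 2 + S⁻¹ / 2)) / (2 * (1 / 2 + S⁻¹ / 2) - 1) =
              -(1 / 2) + 1 / 2 * S := by
            rw [show 2 * (1 / 2 + S⁻¹ / 2) - 1 = S⁻¹ by ring]
            field_simp
            ring
          rw [← h4]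
          exact (hF.component_rate hq (hα i (by omega) h3) hp).congr'
            ((hlam i (by omega) h3).mono fun t ht => by simp only [← ht])
        · exact isBigO_of_tendsto_mul hτ2 (hρrate (hF.density_rate hq hp hX))
      · right
        obtain ⟨C, hC, h1, h2, h3⟩ := hF.critical_rates hcard4 (by
          rw [hprod, hx, heq, div_self hA.ne'])
        refine ⟨rfl, heq.symm, C, hC, h1, fun i h4 h5 => ?_, ?_⟩
        · exact (h2 _ (hα i (by omega) h5)).congr'
            ((hlam i (by omega) h5).mono fun t ht => by simp only [← ht])
        · have := hρrate h3
          rw [inv_div] at this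
          exact_mod_cast this
  · intro hJ3
    obtain ⟨hlt, hX, hp⟩ := hF.supercritical hn (by omega)
    have h2J : 2 * J < n := by omega
    have hcR : ((Finset.Ioc J n).card : ℝ) = (n : ℝ) - J := by
      rw [hcard, Nat.cast_sub hJn]
    rw [hcR] at hp hX
    have hJR : (3 : ℝ) ≤ J := by exact_mod_cast hJ3
    have h2JR : 2 * (J : ℝ) < n := by exact_mod_cast h2J
    have hn4 : (0 : ℝ) < (n : ℝ) - 4 := by linarith
    have hn2J : (0 : ℝ) < (n : ℝ) - 2 * J := by linarith
    have hq : (1 : ℝ) / 2 < ((n : ℝ) - J - 2) / (n - 4) := by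
      rw [lt_div_iff₀ hn4]
      linarith
    have h2q : 2 * (((n : ℝ) - J - 2) / (n - 4)) - 1 = (n - 2 * J) / (n - 4) := by
      field_simp
      ring
    refine ⟨h2J, ((n : ℝ) - J - 2) / (n - 2 * J), ?_, ?_, fun i h1 h2 => ?_, ?_⟩
    · rw [gt_iff_lt, lt_div_iff₀ hn2J]
      linarith
    · have h4 : ((n : ℝ) - J - 2) / (n - 4) / (2 * (((n : ℝ) - J - 2) / (n - 4)) - 1) =
          (n - J - 2) / (n - 2 * J) := by
        rw [h2q]
        field_simp
      rw [← h4]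
      exact hF.l_rate hq hp
    · have h4 : (1 - ((n : ℝ) - J - 2) / (n - 4)) / (2 * (((n : ℝ) - J - 2) / (n - 4)) - 1) =
          (n - J - 2) / (n - 2 * J) - 1 := by
        rw [h2q, one_sub_div hn4.ne', div_div_div_cancel_right₀ hn4.ne', div_sub_one hn2J.ne']
        congr 1
        ring
      rw [← h4]
      exact (hF.component_rate hq (hα i (by omega) h2) hp).congr'
        ((hlam i (by omega) h2).mono fun t ht => by simp only [← ht])
    · exact isBigO_of_tendsto_mul hτ2 (hρrate (hF.density_rate hq hp hX))
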